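/- **Theorem 1.4.** Let $n \ge 1$, let $\psi \in C_c^\infty(\mathbb{R}^n)$ be a real-valued cut-off function supported in $\{|\xi| \le 2\}$ with $\psi = 1$ on $\{|\xi| \le 1\}$, and put $\varphi = \psi - \psi(2\,\cdot)$, $\varphi_k = \varphi(2^{-k}\,\cdot)$ and $\Delta_k = \mathcal{F}^{-1}\varphi_k\mathcal{F}$ for $k \in \mathbb{Z}$. For $s \in \mathbb{R}$, $0 < p < \infty$, $0 < q \le \infty$ and a tempered distribution $u$ on $\mathbb{R}^n$ let $$\|u\|_{\dot F^s_{p,q}} = \Big\| \Big( \sum_{k \in \mathbb{Z}} 2^{ksq} |\Delta_k u|^q \Big)^{1/q} \Big\|_{L^p(\mathbb{R}^n)} \in [0,\infty],$$ with $\sup_{k} 2^{ks} |\Delta_k u|$ in place of the sum when $q = \infty$. The space $\dot F^s_{p,q}$ consists of the tempered distributions (modulo polynomials) for which this quantity is finite. Let $0 < p, p_0, p_1, q < \infty$, $s, s_0, s_1 \in \mathbb{R}$ and $0 < \theta < 1$. Then there is a constant $C$, independent of $u$, such that $$\|u\|_{\dot F^s_{p,q}} \le C\, \|u\|_{\dot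 F^{s_0}_{p_0,\infty}}^{1-\theta}\, \|u\|_{\dot F^{s_1}_{p_1,\infty}}^{\theta} \qquad \text{for all } u \in \dot F^{s_0}_{p_0,\infty} \cap \dot F^{s_1}_{p_1,\infty}$$ if and only if the following three conditions hold: 1. $\dfrac{n}{p} - s = (1-\theta)\Big(\dfrac{n}{p_0} - s_0\Big) + \theta\Big(\dfrac{n}{p_1} - s_1\Big)$; 2. $s \le (1-\theta)s_0 + \theta s_1$; 3. $s_0 \ne s_1$ if $s = (1-\theta)s_0 + \theta s_1$. -/

import Mathlib

open MeasureTheory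
open scoped ENNReal NNReal ContDiff SchwartzMap FourierTransform

noncomputable section

namespace TriebelLizorkin

/-- A Littlewood–Paley cut-off on `ℝⁿ`: a smooth function `ψ` supported in the ball `|ξ| ≤ 2`
which is equal to `1` on the unit ball. -/
structure CutOff (n : ℕ) where
  /-- The function itself. -/
  toFun : EuclideanSpace ℝ (Fin n) → ℝ
  smooth : ContDiff ℝ ∞ toFun
  support_subset : Function.support toFun ⊆ Metric.closedBall 0 2
  eq_one : ∀ ξ, ‖ξ‖ ≤ 1 → toFun ξ = 1

variable {n : ℕ}

/-- `φ = ψ - ψ(2 ·)`. -/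
def CutOff.phi (ψ : CutOff n) (ξ : EuclideanSpace ℝ (Fin n)) : ℝ :=
  ψ.toFun ξ - ψ.toFun ((2 : ℝ) • ξ)

/-- `φ_k(ξ) = φ(2⁻ᵏ ξ)`, for `k ∈ ℤ`. -/
def CutOff.phiK (ψ : CutOff n) (k : ℤ) (ξ : EuclideanSpace ℝ (Fin n)) : ℝ :=
  ψ.phi ((2 : ℝ) ^ (-k) • ξ)

/-- The function `ξ ↦ φ_k(ξ) e^{2πi ⟨x, ξ⟩}`. -/
def CutOff.kernelFun (ψ : CutOff n) (k : ℤ) (x ξ : EuclideanSpace ℝ (Fin n)) : ℂ :=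
  (ψ.phiK k ξ : ℂ) * Complex.exp (((2 * Real.pi * inner ℝ x ξ : ℝ) : ℂ) * Complex.I)

theorem CutOff.contDiff_phiK (ψ : CutOff n) (k : ℤ) : ContDiff ℝ ∞ (ψ.phiK k) := by
  have h := ψ.smooth
  unfold CutOff.phiK CutOff.phi
  fun_prop

theorem CutOff.hasCompactSupport_phiK (ψ : CutOff n) (k : ℤ) :
    HasCompactSupport (ψ.phiK k) := by
  have h2 : (0 : ℝ) < 2 ^ (-k) := by positivity
  refine HasCompactSupport.intro
    (isCompact_closedBall (0 : EuclideanSpace ℝ (Fin n)) (2 / 2 ^ (-k))) fun ξ hξ => ?_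
  have hz : ∀ η : EuclideanSpace ℝ (Fin n), 2 < ‖η‖ → ψ.toFun η = 0 := fun η hη => by
    by_contra hne
    have := ψ.support_subset (Function.mem_support.2 hne)
    rw [mem_closedBall_zero_iff] at this
    linarith
  rw [mem_closedBall_zero_iff, not_le, div_lt_iff₀ h2] at hξ
  have h1 : 2 < ‖(2 : ℝ) ^ (-k) • ξ‖ := by
    rw [norm_smul, Real.norm_of_nonneg h2.le]
    linarith
  have h3 : 2 < ‖(2 : ℝ) • (2 : ℝ) ^ (-k) • ξ‖ := by
    rw [norm_smul (2 : ℝ), Real.norm_of_nonneg (by norm_num)]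
    linarith
  simp only [CutOff.phiK, CutOff.phi]
  rw [hz _ h1, hz _ h3, sub_zero]

theorem CutOff.contDiff_kernelFun (ψ : CutOff n) (k : ℤ) (x : EuclideanSpace ℝ (Fin n)) :
    ContDiff ℝ ∞ (ψ.kernelFun k x) := by
  have h1 : ContDiff ℝ ∞ fun ξ => (ψ.phiK k ξ : ℂ) :=
    Complex.ofRealCLM.contDiff.comp (ψ.contDiff_phiK k)
  have h2 : ContDiff ℝ ∞ fun ξ : EuclideanSpace ℝ (Fin n) =>
      ((2 * Real.pi * inner ℝ x ξ : ℝ) : ℂ) :=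
    Complex.ofRealCLM.contDiff.comp (contDiff_const.mul (contDiff_const.inner ℝ contDiff_id))
  exact h1.mul (h2.mul contDiff_const).cexp

theorem CutOff.hasCompactSupport_kernelFun (ψ : CutOff n) (k : ℤ)
    (x : EuclideanSpace ℝ (Fin n)) : HasCompactSupport (ψ.kernelFun k x) := by
  have h1 : HasCompactSupport fun ξ => (ψ.phiK k ξ : ℂ) :=
    (ψ.hasCompactSupport_phiK k).comp_left (g := fun r : ℝ => (r : ℂ)) Complex.ofReal_zero
  exact h1.mul_right

/-- The function `ξ ↦ φ_k(ξ) e^{2πi ⟨x, ξ⟩}` as a Schwartz function. -/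
def CutOff.kernel (ψ : CutOff n) (k : ℤ) (x : EuclideanSpace ℝ (Fin n)) :
    𝓢(EuclideanSpace ℝ (Fin n), ℂ) :=
  (ψ.hasCompactSupport_kernelFun k x).toSchwartzMap (ψ.contDiff_kernelFun k x)

/-- The dyadic block `Δ_k u = 𝓕⁻¹ (φ_k 𝓕 u)` of a tempered distribution `u`. As `φ_k 𝓕 u` is
compactly supported, this is a smooth function, whose value at `x` is the pairing of `𝓕 u` with
`ξ ↦ φ_k(ξ) e^{2πi ⟨x, ξ⟩}`; equivalently, it is the pairing of `u` with
`y ↦ (𝓕⁻¹ φ_k)(x - y)`. -/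
def block (ψ : CutOff n) (k : ℤ) (u : 𝓢'(EuclideanSpace ℝ (Fin n), ℂ))
    (x : EuclideanSpace ℝ (Fin n)) : ℂ :=
  (𝓕 u) (ψ.kernel k x)

/-- On Schwartz functions the block is the classical `𝓕⁻¹ (φ_k 𝓕 f)`. -/
theorem block_coe (ψ : CutOff n) (k : ℤ) (f : 𝓢(EuclideanSpace ℝ (Fin n), ℂ))
    (x : EuclideanSpace ℝ (Fin n)) :
    block ψ k (f : 𝓢'(EuclideanSpace ℝ (Fin n), ℂ)) x =
      𝓕⁻ (fun ξ => (ψ.phiK k ξ : ℂ) * 𝓕 (f : EuclideanSpace ℝ (Fin n) → ℂ) ξ) x := by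
  rw [block, TemperedDistribution.fourier_toTemperedDistributionCLM_eq, Real.fourierInv_eq',
    SchwartzMap.coe_apply]
  refine integral_congr_ae (Filter.Eventually.of_forall fun ξ => ?_)
  simp only [SchwartzMap.fourier_coe, smul_eq_mul]
  change ψ.kernelFun k x ξ * _ = _
  rw [CutOff.kernelFun, real_inner_comm]
  ring

/-- The pointwise `ℓ^q`-norm `(∑_k 2^{ksq} |Δ_k u(x)|^q)^{1/q}`, or `sup_k 2^{ks} |Δ_k u(x)|`
if `q = ∞`. -/
def squareFun (ψ : CutOff n) (s : ℝ) (q : ℝ≥0∞) (u : 𝓢'(EuclideanSpace ℝ (Fin n), ℂ))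
    (x : EuclideanSpace ℝ (Fin n)) : ℝ≥0∞ :=
  if q = ⊤ then ⨆ k : ℤ, (2 : ℝ≥0∞) ^ ((k : ℝ) * s) * ‖block ψ k u x‖ₑ
  else (∑' k : ℤ, ((2 : ℝ≥0∞) ^ ((k : ℝ) * s) * ‖block ψ k u x‖ₑ) ^ q.toReal) ^ (1 / q.toReal)

/-- The homogeneous Triebel–Lizorkin (quasi-)norm
`‖u‖ = ‖(∑_k 2^{ksq} |Δ_k u|^q)^{1/q}‖_{L^p}`, for `0 < p < ∞` and `0 < q ≤ ∞`, with values in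
`[0, ∞]`. It depends only on the class of `u` modulo polynomials, because every `φ_k` vanishes in
a neighbourhood of the origin. -/
def tlNorm (ψ : CutOff n) (s p : ℝ) (q : ℝ≥0∞) (u : 𝓢'(EuclideanSpace ℝ (Fin n), ℂ)) : ℝ≥0∞ :=
  (∫⁻ x, squareFun ψ s q u x ^ p) ^ (1 / p)

/-- The homogeneous Triebel–Lizorkin space: the tempered distributions (the representatives of
classes modulo polynomials) whose norm is finite. -/
def tlSpace (ψ : CutOff n) (s p : ℝ) (q : ℝ≥0∞) : Set 𝓢'(EuclideanSpace ℝ (Fin n), ℂ) :=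
  {u | tlNorm ψ s p q u < ⊤}

end TriebelLizorkin

end

/-! Sufficiency. Put t = (1-θ)s₀ + θs₁, 1/r = (1-θ)/p₀ + θ/p₁, and let gᵢ be the square function of
order sᵢ with q = ∞, so that 2^{k sᵢ}|Δ_k u(x)| ≤ gᵢ(x) for every k. If s = t and s₀ ≠ s₁, one of
these two bounds is better for small k and the other for large k, both geometrically in the distance
to the crossing index. Hence the full ℓ^q sum at x is at most a constant times g₀^{1-θ} g₁^θ
(`exists_tsum_rpow_le`), and Hölder concludes, because condition 1 then says p = r. If s < t, the
geometric mean still bounds the supremum of order t, even when s₀ = s₁, so u lies in F^t_{r,∞}. It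
remains to embed this space into F^s_{p,q} (`exists_tlNorm_le_of_lt`): the same summation is used,
with Nikolskii's inequality for low frequencies and the square function for high ones.

Nikolskii's inequality (`exists_enorm_block_le`) is needed for every 0 < r < ∞ and every tempered
distribution. It rests on three facts about a block: it is continuous, it grows at most
polynomially, and it is reproduced by convolution with a Schwartz kernel. All three come from
factoring a continuous functional on the Schwartz space through a Banach space of weighted
derivatives.

Necessity. Three families of test functions are used. Dilates of one function force condition 1.
Single wave packets of frequency tending to infinity, whose modulus does not depend on the
frequency, force condition 2. If s = s₀ = s₁, sums of N normalised packets with separated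
frequencies have left side at least of order N^{1/q}, while the norms with q = ∞ stay bounded; this
forces condition 3. -/

open MeasureTheory
open scoped ENNReal NNReal ContDiff SchwartzMap FourierTransform

noncomputable section

namespace TriebelLizorkin

variable {n : ℕ}

/-! ### Convolution of a tempered distribution with a Schwartz function -/

section Reproducing

open scoped BoundedContinuousFunction LineDeriv

variable {V : Type*} [NormedAddCommGroup V] [InnerProductSpace ℝ V]

/-- Bounded continuous functions with values in the multilinear maps that occur as `l`-th
derivatives; the metric on the values is the one that comes from their norm. -/
abbrev BoundedJet (V : Type*) [NormedAddCommGroup V] [InnerProductSpace ℝ V] (l : ℕ) :=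
  @BoundedContinuousFunction V (V [×l]→L[ℝ] ℂ) _ SeminormedAddCommGroup.toPseudoMetricSpace

/-- The weighted derivative `y ↦ ‖y‖ᵏ Dˡ h(y)` of a Schwartz function, as a bounded continuous
function. -/
def weightedDeriv (k l : ℕ) : 𝓢(V, ℂ) →ₗ[ℂ] BoundedJet V l where
  toFun h := BoundedContinuousFunction.ofNormedAddCommGroup
    (fun y => ‖y‖ ^ k • iteratedFDeriv ℝ l h y)
    ((continuous_norm.pow k).smul ((h.smooth l).continuous_iteratedFDeriv le_rfl))
    (SchwartzMap.seminorm ℂ k l h)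
    (fun y => by
      rw [norm_smul, norm_pow, norm_norm]
      exact SchwartzMap.le_seminorm ℂ k l h y)
  map_add' f g := by
    ext y m
    have := iteratedFDeriv_add_apply (f.contDiffAt l (x := y)) (g.contDiffAt l (x := y))
    have h2 : iteratedFDeriv ℝ l (⇑(f + g)) y = iteratedFDeriv ℝ l f y + iteratedFDeriv ℝ l g y :=
      this
    simp only [BoundedContinuousFunction.coe_ofNormedAddCommGroup, h2, smul_add,
      BoundedContinuousFunction.coe_add, Pi.add_apply]
  map_smul' c f := by
    ext y m
    have := iteratedFDeriv_const_smul_apply (a := c) (f.contDiffAt l (x := y))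
    have h2 : iteratedFDeriv ℝ l (⇑(c • f)) y = c • iteratedFDeriv ℝ l f y := this
    simp only [BoundedContinuousFunction.coe_ofNormedAddCommGroup, h2, RingHom.id_apply,
      BoundedContinuousFunction.coe_smul, smul_apply, smul_eq_mul,
      Complex.real_smul]
    ring

theorem weightedDeriv_apply (k l : ℕ) (h : 𝓢(V, ℂ)) (y : V) :
    weightedDeriv k l h y = ‖y‖ ^ k • iteratedFDeriv ℝ l h y := rfl

theorem seminorm_le_norm_weightedDeriv (k l : ℕ) (h : 𝓢(V, ℂ)) :
    SchwartzMap.seminorm ℂ k l h ≤ ‖weightedDeriv k l h‖ := by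
  refine SchwartzMap.seminorm_le_bound ℂ k l h (norm_nonneg _) fun y => ?_
  have := (weightedDeriv k l h).norm_coe_le_norm y
  rwa [weightedDeriv_apply, norm_smul, norm_pow, norm_norm] at this

theorem iteratedFDeriv_compSubConstCLM (l : ℕ) (ρ : 𝓢(V, ℂ)) (x y : V) :
    iteratedFDeriv ℝ l (SchwartzMap.compSubConstCLM ℂ x ρ) y = iteratedFDeriv ℝ l ρ (y - x) :=
  iteratedFDeriv_comp_sub l x y

theorem exists_one_add_pow_mul_iteratedFDeriv_le (ρ : 𝓢(V, ℂ)) (k l : ℕ) :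
    ∃ C : ℝ, 0 ≤ C ∧ ∀ y, (1 + ‖y‖) ^ k * ‖iteratedFDeriv ℝ l ρ y‖ ≤ C :=
  ⟨_, by positivity, fun y => SchwartzMap.one_add_le_sup_seminorm_apply (𝕜 := ℂ) (m := (k, l))
    le_rfl le_rfl ρ y⟩

theorem one_add_norm_le_mul {V : Type*} [NormedAddCommGroup V] (x y : V) :
    1 + ‖y‖ ≤ (1 + ‖x‖) * (1 + ‖y - x‖) := by
  have h : ‖y‖ ≤ ‖x‖ + ‖y - x‖ := by simpa using norm_add_le x (y - x)
  nlinarith [mul_nonneg (norm_nonneg x) (norm_nonneg (y - x))]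

/-- The weight at y is split by 1 + ‖y‖ ≤ (1 + ‖x‖)(1 + ‖y - x‖); the second factor is absorbed by
the decay of ρ. -/
theorem exists_norm_weightedDeriv_compSubConstCLM_le (k l : ℕ) (ρ : 𝓢(V, ℂ)) :
    ∃ C : ℝ, 0 ≤ C ∧ ∀ x, ‖weightedDeriv k l (SchwartzMap.compSubConstCLM ℂ x ρ)‖ ≤
      C * (1 + ‖x‖) ^ k := by
  obtain ⟨C, hC, h⟩ := exists_one_add_pow_mul_iteratedFDeriv_le ρ k l
  refine ⟨C, hC, fun x => (BoundedContinuousFunction.norm_le (by positivity)).2 fun y => ?_⟩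
  rw [weightedDeriv_apply, iteratedFDeriv_compSubConstCLM, norm_smul, norm_pow, norm_norm]
  calc ‖y‖ ^ k * ‖iteratedFDeriv ℝ l ρ (y - x)‖
      ≤ ((1 + ‖x‖) * (1 + ‖y - x‖)) ^ k * ‖iteratedFDeriv ℝ l ρ (y - x)‖ := by
        gcongr
        linarith [one_add_norm_le_mul x y]
    _ = (1 + ‖x‖) ^ k * ((1 + ‖y - x‖) ^ k * ‖iteratedFDeriv ℝ l ρ (y - x)‖) := by
        rw [mul_pow, mul_assoc]
    _ ≤ (1 + ‖x‖) ^ k * C := by gcongr; exact h _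
    _ = C * (1 + ‖x‖) ^ k := mul_comm _ _

/-- Mean value inequality for Dˡρ on the unit ball around y - x₀, with the weight ‖y‖ᵏ frozen. On
that ball ‖y‖ ≤ (2 + ‖x₀‖)(1 + ‖z‖), so the decay of the derivative of order l + 1 gives a Lipschitz
bound uniform in y. -/
theorem continuous_weightedDeriv_compSubConstCLM (k l : ℕ) (ρ : 𝓢(V, ℂ)) :
    Continuous fun x => weightedDeriv k l (SchwartzMap.compSubConstCLM ℂ x ρ) := by
  obtain ⟨C, hC, h⟩ := exists_one_add_pow_mul_iteratedFDeriv_le ρ k (l + 1)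
  rw [continuous_iff_continuousAt]
  intro x₀
  have key : ∀ x ∈ Metric.ball x₀ 1, ‖weightedDeriv k l (SchwartzMap.compSubConstCLM ℂ x ρ) -
      weightedDeriv k l (SchwartzMap.compSubConstCLM ℂ x₀ ρ)‖ ≤
      (2 + ‖x₀‖) ^ k * C * ‖x - x₀‖ := by
    intro x hx
    refine (BoundedContinuousFunction.norm_le (by positivity)).2 fun y => ?_
    rw [BoundedContinuousFunction.sub_apply, weightedDeriv_apply, weightedDeriv_apply,
      iteratedFDeriv_compSubConstCLM, iteratedFDeriv_compSubConstCLM]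
    have hd : Differentiable ℝ (fun z => ‖y‖ ^ k • iteratedFDeriv ℝ l ρ z) :=
      ((ρ.smooth (l + 1)).differentiable_iteratedFDeriv
        (by exact_mod_cast Nat.lt_succ_self l)).fun_const_smul _
    have h0 : y - x₀ ∈ Metric.ball (y - x₀) 1 := Metric.mem_ball_self one_pos
    have h1 : y - x ∈ Metric.ball (y - x₀) 1 := by
      rw [mem_ball_iff_norm] at hx ⊢
      rw [sub_sub_sub_cancel_left, norm_sub_rev]
      exact hx
    have := Convex.norm_image_sub_le_of_norm_fderiv_le (𝕜 := ℝ)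
      (f := fun z => ‖y‖ ^ k • iteratedFDeriv ℝ l ρ z) (C := (2 + ‖x₀‖) ^ k * C)
      (fun z _ => hd z) (fun z hz => ?_) (convex_ball (y - x₀) 1) h0 h1
    · rw [sub_sub_sub_cancel_left, norm_sub_rev x₀] at this
      exact this
    · rw [fderiv_fun_const_smul
        ((ρ.smooth (l + 1)).differentiable_iteratedFDeriv
          (by exact_mod_cast Nat.lt_succ_self l) z), norm_smul, norm_pow, norm_norm,
        norm_fderiv_iteratedFDeriv]
      have hy : ‖y‖ ≤ (2 + ‖x₀‖) * (1 + ‖z‖) := by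
        rw [mem_ball_iff_norm] at hz
        have h3 : ‖y‖ ≤ ‖x₀‖ + ‖z‖ + ‖z - (y - x₀)‖ := by
          have : y = (x₀ + z) - (z - (y - x₀)) := by abel
          calc ‖y‖ = ‖(x₀ + z) - (z - (y - x₀))‖ := by rw [← this]
            _ ≤ ‖x₀ + z‖ + ‖z - (y - x₀)‖ := norm_sub_le _ _
            _ ≤ _ := by gcongr; exact norm_add_le _ _
        nlinarith [mul_nonneg (norm_nonneg x₀) (norm_nonneg z), norm_nonneg z, norm_nonneg x₀]
      calc ‖y‖ ^ k * ‖iteratedFDeriv ℝ (l + 1) ρ z‖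
          ≤ ((2 + ‖x₀‖) * (1 + ‖z‖)) ^ k * ‖iteratedFDeriv ℝ (l + 1) ρ z‖ := by gcongr
        _ = (2 + ‖x₀‖) ^ k * ((1 + ‖z‖) ^ k * ‖iteratedFDeriv ℝ (l + 1) ρ z‖) := by
          rw [mul_pow, mul_assoc]
        _ ≤ _ := by gcongr; exact h z
  rw [ContinuousAt, tendsto_iff_norm_sub_tendsto_zero]
  have hlim : Filter.Tendsto (fun x => (2 + ‖x₀‖) ^ k * C * ‖x - x₀‖) (nhds x₀) (nhds 0) := by
    have : Continuous fun x => (2 + ‖x₀‖) ^ k * C * ‖x - x₀‖ := by fun_prop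
    simpa using this.tendsto x₀
  refine squeeze_zero' (Filter.Eventually.of_forall fun _ => norm_nonneg _) ?_ hlim
  filter_upwards [Metric.ball_mem_nhds x₀ one_pos] with x hx using key x hx

/-- A continuous functional on the Schwartz space factors through finitely many weighted
derivatives. -/
theorem exists_factor_weightedDeriv {T : 𝓢(V, ℂ) →ₗ[ℂ] ℂ} (hT : Continuous T) :
    ∃ (s : Finset (ℕ × ℕ))
      (L : (Π i : s, BoundedJet V i.1.2) →L[ℂ] ℂ),
      ∀ h, T h = L fun i => weightedDeriv i.1.1 i.1.2 h := by
  obtain ⟨s, C, -, hC⟩ := Seminorm.bound_of_continuous (schwartz_withSeminorms ℂ V ℂ)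
    ((normSeminorm ℂ ℂ).comp T) (continuous_norm.comp hT)
  let J : 𝓢(V, ℂ) →ₗ[ℂ] (Π i : s, BoundedJet V i.1.2) :=
    LinearMap.pi fun i => weightedDeriv i.1.1 i.1.2
  have hb : ∀ h, ‖T h‖ ≤ C * ‖J h‖ := by
    intro h
    have h1 : ‖T h‖ ≤ (C • s.sup (schwartzSeminormFamily ℂ V ℂ)) h := hC h
    refine h1.trans ?_
    rw [smul_apply, NNReal.smul_def, smul_eq_mul]
    gcongr
    refine Seminorm.finset_sup_apply_le (norm_nonneg _) fun i hi => ?_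
    exact (seminorm_le_norm_weightedDeriv i.1 i.2 h).trans (norm_le_pi_norm (J h) ⟨i, hi⟩)
  -- The seminorm bound makes T vanish where J does, so T descends to a bounded functional on the
  -- range of J.
  have hker : LinearMap.ker J ≤ LinearMap.ker T := by
    intro h hh
    rw [LinearMap.mem_ker] at hh ⊢
    have := hb h
    rw [hh, norm_zero, mul_zero] at this
    exact norm_le_zero_iff.1 this
  have hf : ∃ f : LinearMap.range J →ₗ[ℂ] ℂ, ∀ h, f ⟨J h, h, rfl⟩ = T h := by
    refine ⟨(LinearMap.ker J).liftQ T hker ∘ₗ J.quotKerEquivRange.symm.toLinearMap, fun h => ?_⟩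
    have : J.quotKerEquivRange.symm ⟨J h, h, rfl⟩ = Submodule.Quotient.mk h := by
      rw [LinearEquiv.symm_apply_eq]
      rfl
    simp [this]
  obtain ⟨f, hf⟩ := hf
  let f' : StrongDual ℂ (LinearMap.range J) := f.mkContinuous C (by
    rintro ⟨_, h, rfl⟩
    rw [hf]
    exact hb h)
  -- Hahn–Banach: the range of J need not be closed or complemented.
  obtain ⟨L, hL, -⟩ := exists_extension_norm_eq (LinearMap.range J) f'
  exact ⟨s, L, fun h => ((hL ⟨J h, h, rfl⟩).trans (hf h)).symm⟩

/-- The convolution `x ↦ T(ρ(· - x))` of a tempered distribution `T` and a Schwartz function `ρ`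
is continuous. -/
theorem continuous_pairing_compSubConstCLM {T : 𝓢(V, ℂ) →ₗ[ℂ] ℂ} (hT : Continuous T)
    (ρ : 𝓢(V, ℂ)) : Continuous fun x => T (SchwartzMap.compSubConstCLM ℂ x ρ) := by
  obtain ⟨s, L, hL⟩ := exists_factor_weightedDeriv hT
  simp_rw [hL]
  exact L.continuous.comp
    (continuous_pi fun i => continuous_weightedDeriv_compSubConstCLM i.1.1 i.1.2 ρ)

theorem exists_norm_pi_weightedDeriv_le (s : Finset (ℕ × ℕ)) (ρ : 𝓢(V, ℂ)) :
    ∃ (N : ℕ) (C : ℝ), 0 ≤ C ∧ ∀ x, ‖(fun i : s => weightedDeriv i.1.1 i.1.2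
      (SchwartzMap.compSubConstCLM ℂ x ρ) : Π i : s, BoundedJet V i.1.2)‖ ≤
        C * (1 + ‖x‖) ^ N := by
  choose C hC h using fun i : s =>
    exists_norm_weightedDeriv_compSubConstCLM_le i.1.1 i.1.2 ρ
  refine ⟨s.sup Prod.fst, ∑ i, C i, Finset.sum_nonneg fun i _ => hC i, fun x => ?_⟩
  have hS : 0 ≤ ∑ i, C i := Finset.sum_nonneg fun i _ => hC i
  refine (pi_norm_le_iff_of_nonneg (by positivity)).2 fun i => (h i x).trans ?_
  gcongr
  · exact Finset.single_le_sum (fun j _ => hC j) (Finset.mem_univ i)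
  · linarith [norm_nonneg x]
  · exact Finset.le_sup (f := Prod.fst) i.2

/-- The convolution `x ↦ T(ρ(· - x))` is of polynomial growth. -/
theorem exists_norm_pairing_compSubConstCLM_le {T : 𝓢(V, ℂ) →ₗ[ℂ] ℂ} (hT : Continuous T)
    (ρ : 𝓢(V, ℂ)) : ∃ (N : ℕ) (C : ℝ), 0 ≤ C ∧
      ∀ x, ‖T (SchwartzMap.compSubConstCLM ℂ x ρ)‖ ≤ C * (1 + ‖x‖) ^ N := by
  obtain ⟨s, L, hL⟩ := exists_factor_weightedDeriv hT
  obtain ⟨N, C, hC, h⟩ := exists_norm_pi_weightedDeriv_le s ρ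
  refine ⟨N, ‖L‖ * C, by positivity, fun x => ?_⟩
  rw [hL, mul_assoc]
  exact L.le_opNorm_of_le (h x)

variable [FiniteDimensional ℝ V] [MeasurableSpace V] [BorelSpace V]

/-- The hypothesis is κ * ρ = ρ read on the Fourier side. -/
theorem integral_mul_sub_eq {κ ρ : 𝓢(V, ℂ)} (h : ∀ ξ, 𝓕 κ ξ * 𝓕 ρ ξ = 𝓕 ρ ξ) (v : V) :
    ∫ w, κ w * ρ (v - w) = ρ v := by
  have h1 : SchwartzMap.convolution (ContinuousLinearMap.mul ℂ ℂ) κ ρ = ρ := by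
    have h2 : 𝓕 (SchwartzMap.convolution (ContinuousLinearMap.mul ℂ ℂ) κ ρ) = 𝓕 ρ := by
      rw [SchwartzMap.fourier_convolution]
      ext ξ
      rw [SchwartzMap.pairing_apply_apply]
      exact h ξ
    simpa using congrArg (fun f : 𝓢(V, ℂ) => 𝓕⁻ f) h2
  have h3 := SchwartzMap.convolution_apply (ContinuousLinearMap.mul ℂ ℂ) κ ρ v
  rw [h1] at h3
  exact h3.symm

theorem fourier_mul_lineDerivOp {κ ρ : 𝓢(V, ℂ)} (h : ∀ ξ, 𝓕 κ ξ * 𝓕 ρ ξ = 𝓕 ρ ξ) (m : V)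
    (ξ : V) : 𝓕 κ ξ * 𝓕 (∂_{m} ρ) ξ = 𝓕 (∂_{m} ρ) ξ := by
  rw [SchwartzMap.fourier_lineDerivOp_eq]
  have hg : (fun x : V => inner ℝ x m).HasTemperateGrowth := by fun_prop
  rw [smul_apply, SchwartzMap.smulLeftCLM_apply_apply hg, Complex.real_smul, smul_eq_mul]
  linear_combination (2 * Real.pi * Complex.I) * (inner ℝ ξ m : ℂ) * h ξ

/-- Differentiation only multiplies 𝓕ρ by a polynomial, so κ reproduces all derivatives of ρ. This
is needed to check the reproducing formula in the space of jets. -/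
theorem fourier_mul_iteratedLineDerivOp {κ : 𝓢(V, ℂ)} {l : ℕ} (m : Fin l → V) (ρ : 𝓢(V, ℂ))
    (h : ∀ ξ, 𝓕 κ ξ * 𝓕 ρ ξ = 𝓕 ρ ξ) (ξ : V) :
    𝓕 κ ξ * 𝓕 (∂^{m} ρ) ξ = 𝓕 (∂^{m} ρ) ξ := by
  induction l generalizing ξ with
  | zero => simpa using h ξ
  | succ l ih =>
    rw [LineDeriv.iteratedLineDerivOp_succ_left]
    exact fourier_mul_lineDerivOp (ih (Fin.tail m)) _ ξ

theorem integrable_one_add_pow_mul (f : 𝓢(V, ℂ)) (N : ℕ) :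
    Integrable (fun y => (1 + ‖y‖) ^ N * ‖f y‖) := by
  have h : (fun y => (1 + ‖y‖) ^ N * ‖f y‖) =
      fun y => ∑ j ∈ Finset.range (N + 1), (N.choose j : ℝ) * (‖y‖ ^ j * ‖f y‖) := by
    ext y
    rw [add_comm, add_pow, Finset.sum_mul]
    refine Finset.sum_congr rfl fun j _ => ?_
    ring
  rw [h]
  exact integrable_finsetSum _ fun j _ => (f.integrable_pow_mul volume j).const_mul _

/-- If `κ * ρ = ρ`, then convolution with `κ` reproduces `x ↦ T(ρ(· - x))`. -/
theorem integral_mul_pairing_compSubConstCLM {T : 𝓢(V, ℂ) →ₗ[ℂ] ℂ} (hT : Continuous T)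
    {κ ρ : 𝓢(V, ℂ)} (h : ∀ ξ, 𝓕 κ ξ * 𝓕 ρ ξ = 𝓕 ρ ξ) (x : V) :
    T (SchwartzMap.compSubConstCLM ℂ x ρ) =
      ∫ y, κ (y - x) * T (SchwartzMap.compSubConstCLM ℂ y ρ) := by
  obtain ⟨s, L, hL⟩ := exists_factor_weightedDeriv hT
  obtain ⟨N, C, hC, hb⟩ := exists_norm_pi_weightedDeriv_le s ρ
  let J : 𝓢(V, ℂ) → Π i : s, BoundedJet V i.1.2 := fun g i => weightedDeriv i.1.1 i.1.2 g
  have hJc : Continuous fun y => J (SchwartzMap.compSubConstCLM ℂ y ρ) :=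
    continuous_pi fun i => continuous_weightedDeriv_compSubConstCLM i.1.1 i.1.2 ρ
  have hκ : ∀ y, κ (y - x) = SchwartzMap.compSubConstCLM ℂ x κ y := fun y => rfl
  -- The integral is a Bochner integral in the Banach space of jets; Schwartz decay of κ beats the
  -- polynomial growth of the translates.
  have hint : Integrable fun y => κ (y - x) • J (SchwartzMap.compSubConstCLM ℂ y ρ) := by
    have hg := (integrable_one_add_pow_mul (SchwartzMap.compSubConstCLM ℂ x κ) N).const_mul C
    refine Integrable.mono' (β := Π i : s, BoundedJet V i.1.2) hg ?_
      (Filter.Eventually.of_forall fun y => ?_)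
    · have hc : Continuous fun y => κ (y - x) • J (SchwartzMap.compSubConstCLM ℂ y ρ) :=
        Continuous.smul (f := fun y => κ (y - x)) (by fun_prop) hJc
      exact hc.aestronglyMeasurable
    · refine (norm_smul_le _ _).trans ?_
      rw [hκ]
      calc _ ≤ ‖SchwartzMap.compSubConstCLM ℂ x κ y‖ * (C * (1 + ‖y‖) ^ N) := by
            gcongr
            exact hb y
        _ = _ := by ring
  -- An identity between jets may be tested by the evaluations `ev`, which are continuous and so
  -- pass under the integral; there it is κ * ∂ρ = ∂ρ.
  have hJ : J (SchwartzMap.compSubConstCLM ℂ x ρ) =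
      ∫ y, κ (y - x) • J (SchwartzMap.compSubConstCLM ℂ y ρ) := by
    funext i
    ext z m
    let ev : (Π i : s, BoundedJet V i.1.2) →L[ℂ] ℂ :=
      LinearMap.mkContinuous
        { toFun := fun g => g i z m
          map_add' := fun _ _ => rfl
          map_smul' := fun _ _ => rfl }
        (∏ j, ‖m j‖) (fun g => by
          refine ((g i z).le_opNorm m).trans ?_
          rw [mul_comm]
          gcongr
          exact ((g i).norm_coe_le_norm z).trans (norm_le_pi_norm g i))
    change ev (J _) = ev (∫ y, κ (y - x) • J (SchwartzMap.compSubConstCLM ℂ y ρ))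
    rw [← ContinuousLinearMap.integral_comp_comm (E := Π i : s, BoundedJet V i.1.2) ev hint]
    have hev : ∀ y, ev (J (SchwartzMap.compSubConstCLM ℂ y ρ)) =
        (‖z‖ ^ i.1.1 : ℝ) * (∂^{m} ρ) (z - y) := by
      intro y
      change (‖z‖ ^ i.1.1 • iteratedFDeriv ℝ i.1.2 (SchwartzMap.compSubConstCLM ℂ y ρ) z) m = _
      rw [iteratedFDeriv_compSubConstCLM, smul_apply, Complex.real_smul,
        SchwartzMap.iteratedLineDerivOp_eq_iteratedFDeriv]
    simp_rw [map_smul, hev, smul_eq_mul]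
    have h2 := integral_mul_sub_eq (fourier_mul_iteratedLineDerivOp m ρ h) (z - x)
    rw [← h2, ← integral_const_mul]
    rw [← integral_sub_right_eq_self _ x]
    refine integral_congr_ae (Filter.Eventually.of_forall fun y => ?_)
    simp only [sub_sub_sub_cancel_right]
    ring
  rw [hL]
  change L (J _) = _
  rw [hJ, ← ContinuousLinearMap.integral_comp_comm (E := Π i : s, BoundedJet V i.1.2) L hint]
  refine integral_congr_ae (Filter.Eventually.of_forall fun y => ?_)
  simp only [map_smul, smul_eq_mul]
  rw [hL]

end Reproducing

/-! ### Powers of two in `ℝ≥0∞` and dyadic dilations -/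

section DyadicDilation

theorem two_rpow_ne_zero (t : ℝ) : (2 : ℝ≥0∞) ^ t ≠ 0 := by
  simp [ENNReal.rpow_eq_zero_iff]

theorem two_rpow_ne_top (t : ℝ) : (2 : ℝ≥0∞) ^ t ≠ ⊤ :=
  ENNReal.rpow_ne_top_of_ne_zero two_ne_zero ENNReal.ofNat_ne_top

theorem two_rpow_add (s t : ℝ) : (2 : ℝ≥0∞) ^ (s + t) = 2 ^ s * 2 ^ t :=
  ENNReal.rpow_add s t two_ne_zero ENNReal.ofNat_ne_top

theorem ofReal_two_zpow_pow (k : ℤ) (d : ℕ) :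
    ENNReal.ofReal (((2 : ℝ) ^ k) ^ d) = (2 : ℝ≥0∞) ^ ((k : ℝ) * d) := by
  rw [← Real.rpow_intCast, ← Real.rpow_natCast, ← Real.rpow_mul zero_le_two,
    ← ENNReal.ofReal_rpow_of_pos two_pos, ENNReal.ofReal_ofNat]

variable {V : Type*} [NormedAddCommGroup V] [InnerProductSpace ℝ V]

/-- The dyadic dilation `ξ ↦ g(2⁻ᵏ ξ)` of a Schwartz function. -/
def dyadic (k : ℤ) (g : 𝓢(V, ℂ)) : 𝓢(V, ℂ) :=
  SchwartzMap.compCLMOfContinuousLinearEquiv ℂ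
    (ContinuousLinearEquiv.smulLeft (Units.mk0 ((2 : ℝ) ^ (-k)) (by positivity)) : V ≃L[ℝ] V) g

theorem dyadic_apply (k : ℤ) (g : 𝓢(V, ℂ)) (ξ : V) :
    dyadic k g ξ = g ((2 : ℝ) ^ (-k) • ξ) := rfl

variable [FiniteDimensional ℝ V] [MeasurableSpace V] [BorelSpace V]

theorem lintegral_comp_two_zpow_smul (f : V → ℝ≥0∞) (k : ℤ) :
    (2 : ℝ≥0∞) ^ ((k : ℝ) * Module.finrank ℝ V) * ∫⁻ x, f ((2 : ℝ) ^ k • x) = ∫⁻ x, f x := by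
  have h2 : (2 : ℝ) ^ k ≠ 0 := by positivity
  have h := lintegral_map_equiv (μ := (volume : Measure V)) f
    (Homeomorph.smulOfNeZero ((2 : ℝ) ^ k) h2).toMeasurableEquiv
  have h3 : Measure.map (⇑(Homeomorph.smulOfNeZero ((2 : ℝ) ^ k) h2).toMeasurableEquiv)
      (volume : Measure V) = ENNReal.ofReal |(((2 : ℝ) ^ k) ^ Module.finrank ℝ V)⁻¹| • volume :=
    Measure.map_addHaar_smul volume h2
  rw [h3, lintegral_smul_measure] at h
  change _ = ∫⁻ x, f ((2 : ℝ) ^ k • x) at h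
  rw [← h, smul_eq_mul, ← mul_assoc, abs_of_pos (by positivity), ENNReal.ofReal_inv_of_pos
    (by positivity), ofReal_two_zpow_pow,
    ENNReal.mul_inv_cancel (two_rpow_ne_zero _) (two_rpow_ne_top _), one_mul]

theorem fourier_dyadic_apply (k : ℤ) (g : 𝓢(V, ℂ)) (y : V) :
    𝓕 (dyadic k g) y = ((((2 : ℝ) ^ k) ^ Module.finrank ℝ V : ℝ) : ℂ) * 𝓕 g ((2 : ℝ) ^ k • y) := by
  rw [SchwartzMap.fourier_coe, SchwartzMap.fourier_coe, Real.fourier_eq', Real.fourier_eq']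
  have h := Measure.integral_comp_smul (volume : Measure V) (fun v =>
    Complex.exp (↑(-2 * Real.pi * inner ℝ v ((2 : ℝ) ^ k • y)) * Complex.I) • g v) ((2 : ℝ) ^ (-k))
  have h2 : |(((2 : ℝ) ^ (-k)) ^ Module.finrank ℝ V)⁻¹| = ((2 : ℝ) ^ k) ^ Module.finrank ℝ V := by
    rw [abs_of_pos (by positivity), ← inv_pow, zpow_neg, inv_inv]
  rw [h2, Complex.real_smul] at h
  rw [← h]
  refine integral_congr_ae (Filter.Eventually.of_forall fun v => ?_)
  simp only [dyadic_apply, inner_smul_left, inner_smul_right, conj_trivial]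
  congr 6
  rw [← mul_assoc, ← zpow_add₀ two_ne_zero, add_neg_cancel, zpow_zero, one_mul]

theorem enorm_fourier_dyadic_apply (k : ℤ) (g : 𝓢(V, ℂ)) (y : V) :
    ‖𝓕 (dyadic k g) y‖ₑ =
      (2 : ℝ≥0∞) ^ ((k : ℝ) * Module.finrank ℝ V) * ‖𝓕 g ((2 : ℝ) ^ k • y)‖ₑ := by
  rw [fourier_dyadic_apply, enorm_mul, ← ofReal_two_zpow_pow]
  congr 1
  rw [← ofReal_norm, Complex.norm_real, Real.norm_of_nonneg (by positivity)]

theorem lintegral_enorm_fourier_dyadic (k : ℤ) (g : 𝓢(V, ℂ)) :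
    ∫⁻ y, ‖𝓕 (dyadic k g) y‖ₑ = ∫⁻ y, ‖𝓕 g y‖ₑ := by
  simp_rw [enorm_fourier_dyadic_apply]
  rw [lintegral_const_mul' _ _ (two_rpow_ne_top _),
    lintegral_comp_two_zpow_smul (fun y => ‖𝓕 g y‖ₑ)]

end DyadicDilation

/-! ### Blocks as continuous functions with a reproducing kernel -/

section Block

theorem CutOff.toFun_eq_zero (ψ : CutOff n) {ξ : EuclideanSpace ℝ (Fin n)} (h : 2 < ‖ξ‖) :
    ψ.toFun ξ = 0 := by
  by_contra hne
  have := ψ.support_subset (Function.mem_support.2 hne)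
  rw [mem_closedBall_zero_iff] at this
  linarith

theorem CutOff.phi_eq_zero (ψ : CutOff n) {ξ : EuclideanSpace ℝ (Fin n)} (h : 2 < ‖ξ‖) :
    ψ.phi ξ = 0 := by
  rw [CutOff.phi, ψ.toFun_eq_zero h, ψ.toFun_eq_zero, sub_zero]
  rw [norm_smul, Real.norm_of_nonneg zero_le_two]
  linarith

/-- `φ` as a Schwartz function. -/
def CutOff.phiSchwartz (ψ : CutOff n) : 𝓢(EuclideanSpace ℝ (Fin n), ℂ) :=
  HasCompactSupport.toSchwartzMap (f := fun ξ => (ψ.phi ξ : ℂ))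
    (by
      have h := (ψ.hasCompactSupport_phiK 0).comp_left (g := fun r : ℝ => (r : ℂ))
        Complex.ofReal_zero
      simpa [Function.comp_def, CutOff.phiK] using h)
    (by
      have h := Complex.ofRealCLM.contDiff.comp (ψ.contDiff_phiK 0)
      simpa [Function.comp_def, CutOff.phiK] using h)

theorem CutOff.phiSchwartz_apply (ψ : CutOff n) (ξ : EuclideanSpace ℝ (Fin n)) :
    ψ.phiSchwartz ξ = (ψ.phi ξ : ℂ) := rfl

/-- The Schwartz function `ξ ↦ ψ(ξ / 2)`, which is equal to `1` on the support of `φ`. -/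
def CutOff.wideSchwartz (ψ : CutOff n) : 𝓢(EuclideanSpace ℝ (Fin n), ℂ) :=
  HasCompactSupport.toSchwartzMap (f := fun ξ => (ψ.toFun ((2 : ℝ)⁻¹ • ξ) : ℂ))
    (HasCompactSupport.intro
      (isCompact_closedBall (0 : EuclideanSpace ℝ (Fin n)) 4) fun ξ hξ => by
        rw [mem_closedBall_zero_iff, not_le] at hξ
        rw [ψ.toFun_eq_zero, Complex.ofReal_zero]
        rw [norm_smul, Real.norm_of_nonneg (by norm_num)]
        linarith)
    (Complex.ofRealCLM.contDiff.comp (ψ.smooth.comp (contDiff_const_smul _)))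

theorem CutOff.wideSchwartz_apply (ψ : CutOff n) (ξ : EuclideanSpace ℝ (Fin n)) :
    ψ.wideSchwartz ξ = (ψ.toFun ((2 : ℝ)⁻¹ • ξ) : ℂ) := rfl

theorem CutOff.wideSchwartz_mul_phiSchwartz (ψ : CutOff n) (ξ : EuclideanSpace ℝ (Fin n)) :
    ψ.wideSchwartz ξ * ψ.phiSchwartz ξ = ψ.phiSchwartz ξ := by
  rw [ψ.wideSchwartz_apply, ψ.phiSchwartz_apply]
  rcases le_or_gt ‖ξ‖ 2 with h | h
  · rw [ψ.eq_one, Complex.ofReal_one, one_mul]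
    rw [norm_smul, Real.norm_of_nonneg (by norm_num)]
    linarith
  · rw [ψ.phi_eq_zero h, Complex.ofReal_zero, mul_zero]

theorem fourier_fourier_apply {V : Type*} [NormedAddCommGroup V] [InnerProductSpace ℝ V]
    [FiniteDimensional ℝ V] [MeasurableSpace V] [BorelSpace V] (g : 𝓢(V, ℂ)) (ξ : V) :
    𝓕 (𝓕 g) ξ = g (-ξ) := by
  have h : 𝓕⁻ (𝓕 g) (-ξ) = g (-ξ) := by rw [FourierPair.fourierInv_fourier_eq]
  rw [← h, SchwartzMap.fourierInv_coe, Real.fourierInv_eq_fourier_neg, neg_neg,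
    SchwartzMap.fourier_coe]

/-- A double Fourier transform is a reflection, so this is the fact that ψ(·/2) = 1 on the support
of φ, dilated. It is the hypothesis of the reproducing formula. -/
theorem fourier_wide_mul_fourier_phi (ψ : CutOff n) (k : ℤ) (ξ : EuclideanSpace ℝ (Fin n)) :
    𝓕 (𝓕 (dyadic k ψ.wideSchwartz)) ξ * 𝓕 (𝓕 (dyadic k ψ.phiSchwartz)) ξ =
      𝓕 (𝓕 (dyadic k ψ.phiSchwartz)) ξ := by
  simp only [fourier_fourier_apply, dyadic_apply, ψ.wideSchwartz_mul_phiSchwartz]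

/-- Turns a block into a convolution: the exponential becomes a translation by x. The kernel is
evaluated at y - x rather than x - y, hence 𝓕 and not 𝓕⁻. -/
theorem fourier_kernel (ψ : CutOff n) (k : ℤ) (x : EuclideanSpace ℝ (Fin n)) :
    𝓕 (ψ.kernel k x) = SchwartzMap.compSubConstCLM ℂ x (𝓕 (dyadic k ψ.phiSchwartz)) := by
  ext y
  rw [SchwartzMap.compSubConstCLM_apply, SchwartzMap.fourier_coe, SchwartzMap.fourier_coe,
    Real.fourier_eq', Real.fourier_eq']
  refine integral_congr_ae (Filter.Eventually.of_forall fun ξ => ?_)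
  change _ • ψ.kernelFun k x ξ = _ • (ψ.phiK k ξ : ℂ)
  rw [CutOff.kernelFun, smul_eq_mul, smul_eq_mul, mul_left_comm, ← Complex.exp_add, mul_comm]
  congr 2
  rw [inner_sub_right, real_inner_comm x ξ]
  push_cast
  ring

theorem block_eq (ψ : CutOff n) (k : ℤ) (u : 𝓢'(EuclideanSpace ℝ (Fin n), ℂ))
    (x : EuclideanSpace ℝ (Fin n)) :
    block ψ k u x = u (SchwartzMap.compSubConstCLM ℂ x (𝓕 (dyadic k ψ.phiSchwartz))) := by
  rw [block, TemperedDistribution.fourier_apply, fourier_kernel]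

theorem continuous_block (ψ : CutOff n) (k : ℤ) (u : 𝓢'(EuclideanSpace ℝ (Fin n), ℂ)) :
    Continuous (block ψ k u) := by
  rw [funext (block_eq ψ k u)]
  exact continuous_pairing_compSubConstCLM
    (T := (u : 𝓢(EuclideanSpace ℝ (Fin n), ℂ) →ₗ[ℂ] ℂ)) (map_continuous u) _

theorem exists_norm_block_le (ψ : CutOff n) (k : ℤ) (u : 𝓢'(EuclideanSpace ℝ (Fin n), ℂ)) :
    ∃ (N : ℕ) (C : ℝ), 0 ≤ C ∧ ∀ x, ‖block ψ k u x‖ ≤ C * (1 + ‖x‖) ^ N := by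
  simp_rw [block_eq ψ k u]
  exact exists_norm_pairing_compSubConstCLM_le
    (T := (u : 𝓢(EuclideanSpace ℝ (Fin n), ℂ) →ₗ[ℂ] ℂ)) (map_continuous u) _

theorem block_eq_integral (ψ : CutOff n) (k : ℤ) (u : 𝓢'(EuclideanSpace ℝ (Fin n), ℂ))
    (x : EuclideanSpace ℝ (Fin n)) :
    block ψ k u x = ∫ y, 𝓕 (dyadic k ψ.wideSchwartz) (y - x) * block ψ k u y := by
  simp_rw [block_eq ψ k u]
  exact integral_mul_pairing_compSubConstCLM
    (T := (u : 𝓢(EuclideanSpace ℝ (Fin n), ℂ) →ₗ[ℂ] ℂ)) (map_continuous u)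
    (fourier_wide_mul_fourier_phi ψ k) x

end Block

/-! ### Sup bounds for functions dominated by their own convolution -/

section Nikolskii

variable {V : Type*} [NormedAddCommGroup V]

theorem one_add_enorm_le_mul (x y : V) : 1 + ‖y‖ₑ ≤ (1 + ‖x‖ₑ) * (1 + ‖y - x‖ₑ) := by
  have h : ‖y‖ₑ ≤ ‖x‖ₑ + ‖y - x‖ₑ := by simpa using enorm_add_le x (y - x)
  calc 1 + ‖y‖ₑ ≤ 1 + (‖x‖ₑ + ‖y - x‖ₑ) := by gcongr
    _ ≤ 1 + (‖x‖ₑ + ‖y - x‖ₑ) + ‖x‖ₑ * ‖y - x‖ₑ := le_self_add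
    _ = _ := by ring

variable [MeasurableSpace V]

/-- Let S be the supremum of f over the weight w centred at x. Writing f = f^r f^{1-r} ≤ f^r S^{1-r}
w inside the convolution gives S ≤ S^{1-r} B ∫ f^r, and S^{1-r} cancels because S is finite. The
growth constant A does not enter the conclusion. -/
theorem rpow_le_mul_lintegral_of_le_one {f K : V → ℝ≥0∞} {μ : Measure V} {r : ℝ} (hr : 0 < r)
    (hr1 : r ≤ 1) {N : ℕ} {A B : ℝ≥0∞} (hA : A ≠ ⊤) (hB : B ≠ ⊤)
    (hf : ∀ x, f x ≤ A * (1 + ‖x‖ₑ) ^ N)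
    (hK : ∀ z, K z * (1 + ‖z‖ₑ) ^ N ≤ B) (hrep : ∀ x, f x ≤ ∫⁻ y, K (y - x) * f y ∂μ) (x : V) :
    f x ^ r ≤ B * ∫⁻ y, f y ^ r ∂μ := by
  have hr' : 0 ≤ 1 - r := by linarith
  set w : V → ℝ≥0∞ := fun y => (1 + ‖y - x‖ₑ) ^ N with hw
  have hw0 : ∀ y, w y ≠ 0 := fun y => by simp [hw]
  have hwt : ∀ y, w y ≠ ⊤ := fun y => by simp [hw]
  have hw1 : ∀ y, 1 ≤ w y := fun y => one_le_pow₀ le_self_add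
  set S : ℝ≥0∞ := ⨆ y, f y / w y with hS
  have hSt : S ≠ ⊤ := by
    -- The only use of polynomial growth: S must be finite before it can be cancelled.
    refine ne_top_of_le_ne_top (b := A * (1 + ‖x‖ₑ) ^ N) (by finiteness) (iSup_le fun y => ?_)
    rw [ENNReal.div_le_iff (hw0 y) (hwt y)]
    refine (hf y).trans ?_
    rw [mul_assoc, ← mul_pow]
    gcongr
    exact one_add_enorm_le_mul x y
  have hfS : ∀ y, f y ≤ S * w y := fun y => by
    rw [← ENNReal.div_le_iff (hw0 y) (hwt y)]
    exact le_iSup (fun y => f y / w y) y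
  have hfr : ∀ y, f y ≤ f y ^ r * (S ^ (1 - r) * w y) := fun y => by
    calc f y = f y ^ r * f y ^ (1 - r) := by
          rw [← ENNReal.rpow_add_of_nonneg _ _ hr.le hr', add_sub_cancel, ENNReal.rpow_one]
      _ ≤ f y ^ r * (S ^ (1 - r) * w y) := by
          gcongr
          calc f y ^ (1 - r) ≤ (S * w y) ^ (1 - r) := by gcongr; exact hfS y
            _ = S ^ (1 - r) * w y ^ (1 - r) := ENNReal.mul_rpow_of_nonneg _ _ hr'
            _ ≤ S ^ (1 - r) * w y := by
              gcongr
              calc w y ^ (1 - r) ≤ w y ^ (1 : ℝ) :=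
                    ENNReal.rpow_le_rpow_of_exponent_le (hw1 y) (by linarith)
                _ = w y := ENNReal.rpow_one _
  have hSle : S ≤ S ^ (1 - r) * (B * ∫⁻ y, f y ^ r ∂μ) := by
    refine iSup_le fun z => ?_
    rw [ENNReal.div_le_iff (hw0 z) (hwt z)]
    refine (hrep z).trans ?_
    calc ∫⁻ y, K (y - z) * f y ∂μ ≤ ∫⁻ y, (S ^ (1 - r) * w z * B) * f y ^ r ∂μ := by
          refine lintegral_mono fun y => ?_
          calc K (y - z) * f y ≤ K (y - z) * (f y ^ r * (S ^ (1 - r) * w y)) := by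
                gcongr; exact hfr y
            _ ≤ K (y - z) * (f y ^ r * (S ^ (1 - r) * (w z * (1 + ‖y - z‖ₑ) ^ N))) := by
                gcongr
                rw [hw]
                simp only
                rw [← mul_pow]
                gcongr
                simpa using one_add_enorm_le_mul (z - x) (y - x)
            _ = (S ^ (1 - r) * w z) * (K (y - z) * (1 + ‖y - z‖ₑ) ^ N) * f y ^ r := by ring
            _ ≤ _ := by gcongr; exact hK _
      _ ≤ (S ^ (1 - r) * w z * B) * ∫⁻ y, f y ^ r ∂μ := by
          rw [lintegral_const_mul']
          have := ENNReal.rpow_ne_top_of_nonneg hr' hSt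
          have := hwt z
          finiteness
      _ = _ := by ring
  have hfx : f x ≤ S := by simpa [hw] using hfS x
  by_cases hS0 : S = 0
  · rw [le_zero_iff.1 (hfx.trans hS0.le), ENNReal.zero_rpow_of_pos hr]
    exact zero_le
  · refine (ENNReal.rpow_le_rpow hfx hr.le).trans ?_
    have h1 : S ^ (1 - r) * S ^ r = S := by
      rw [← ENNReal.rpow_add _ _ hS0 hSt, sub_add_cancel, ENNReal.rpow_one]
    have h2 : S ^ (1 - r) * S ^ r ≤ S ^ (1 - r) * (B * ∫⁻ y, f y ^ r ∂μ) := by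
      rw [h1]; exact hSle
    rwa [ENNReal.mul_le_mul_iff_right] at h2
    · simp [ENNReal.rpow_eq_zero_iff, hS0, hSt]
    · exact ENNReal.rpow_ne_top_of_nonneg hr' hSt

/-- A substitute for Hölder that needs no conjugate exponent: f is split at a height ε, the part
below ε is integrated against the L¹ bound M of K, the part above against its sup bound D b. The
choice ε = (D ∫ f^r)^{1/r} balances both. -/
theorem le_mul_lintegral_of_one_le [BorelSpace V] {f K : V → ℝ≥0∞} {μ : Measure V}
    [μ.IsAddRightInvariant] {r : ℝ} (hr : 1 ≤ r)
    {D b M : ℝ≥0∞} (hb : b ≠ 0) (hD : D ≠ 0) (hDt : D ≠ ⊤)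
    (hfm : Measurable f) (hK : ∀ z, K z ≤ D * b) (hM : ∫⁻ z, K z ∂μ ≤ M)
    (hrep : ∀ x, f x ≤ ∫⁻ y, K (y - x) * f y ∂μ) (x : V) :
    f x ≤ (M + b) * (D * ∫⁻ y, f y ^ r ∂μ) ^ (1 / r) := by
  have hr0 : 0 < r := by linarith
  set I := ∫⁻ y, f y ^ r ∂μ with hI
  rcases eq_or_ne I ⊤ with hIt | hIt
  · rw [hIt, ENNReal.mul_top hD, ENNReal.top_rpow_of_pos (by positivity), ENNReal.mul_top]
    · exact le_top
    · simp [hb]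
  rcases eq_or_ne I 0 with hI0 | hI0
  · rw [hI, lintegral_eq_zero_iff (hfm.pow_const r)] at hI0
    have : ∫⁻ y, K (y - x) * f y ∂μ = 0 := by
      rw [← lintegral_zero]
      refine lintegral_congr_ae ?_
      filter_upwards [hI0] with y hy
      have : f y = 0 := by
        simpa [ENNReal.rpow_eq_zero_iff, hr0, hr0.le, not_lt.2 hr0.le] using hy
      rw [this, mul_zero]
    exact (hrep x).trans (this.le.trans zero_le)
  set ε := (D * I) ^ (1 / r) with hε
  have hDI0 : D * I ≠ 0 := mul_ne_zero hD hI0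
  have hDIt : D * I ≠ ⊤ := ENNReal.mul_ne_top hDt hIt
  have hε0 : ε ≠ 0 := by simp [hε, ENNReal.rpow_eq_zero_iff, hDI0, hDIt]
  have hεt : ε ≠ ⊤ := ENNReal.rpow_ne_top_of_nonneg (by positivity) hDIt
  have hεr0 : ε ^ (r - 1) ≠ 0 := by simp [ENNReal.rpow_eq_zero_iff, hε0, hεt]
  have hεrt : ε ^ (r - 1) ≠ ⊤ := ENNReal.rpow_ne_top_of_nonneg (by linarith) hεt
  have hεr : D * I = ε * ε ^ (r - 1) := by
    have h1 : ε * ε ^ (r - 1) = ε ^ r := by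
      nth_rewrite 1 [← ENNReal.rpow_one ε]
      rw [← ENNReal.rpow_add _ _ hε0 hεt, add_sub_cancel]
    rw [h1, hε, ← ENNReal.rpow_mul, one_div_mul_cancel hr0.ne', ENNReal.rpow_one]
  have ht : ∀ t : ℝ≥0∞, t ≤ ε + t ^ r / ε ^ (r - 1) := fun t => by
    rcases le_total t ε with h | h
    · exact h.trans le_self_add
    · refine le_trans ?_ le_add_self
      rw [ENNReal.le_div_iff_mul_le (Or.inl hεr0) (Or.inl hεrt)]
      calc t * ε ^ (r - 1) ≤ t * t ^ (r - 1) := by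
            gcongr
        _ = t ^ r := by
            nth_rewrite 1 [← ENNReal.rpow_one t]
            rw [← ENNReal.rpow_add_of_nonneg _ _ zero_le_one (by linarith), add_sub_cancel]
  calc f x ≤ ∫⁻ y, K (y - x) * f y ∂μ := hrep x
    _ ≤ ∫⁻ y, (K (y - x) * ε + D * b / ε ^ (r - 1) * f y ^ r) ∂μ := by
        refine lintegral_mono fun y => ?_
        calc K (y - x) * f y ≤ K (y - x) * (ε + f y ^ r / ε ^ (r - 1)) := by gcongr; exact ht _
          _ = K (y - x) * ε + K (y - x) / ε ^ (r - 1) * f y ^ r := by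
              simp only [div_eq_mul_inv]; ring
          _ ≤ _ := by gcongr; exact hK _
    _ = (∫⁻ y, K (y - x) ∂μ) * ε + D * b / ε ^ (r - 1) * I := by
        rw [lintegral_add_right _ ((hfm.pow_const r).const_mul _),
          lintegral_mul_const' _ _ hεt, lintegral_const_mul _ (hfm.pow_const r)]
    _ = (∫⁻ y, K y ∂μ) * ε + D * I * b / ε ^ (r - 1) := by
        rw [lintegral_sub_right_eq_self]
        simp only [div_eq_mul_inv]; ring
    _ = (∫⁻ y, K y ∂μ) * ε + b * ε := by
        rw [hεr]
        congr 1
        rw [mul_right_comm, mul_div_assoc, ENNReal.div_self hεr0 hεrt, mul_one, mul_comm]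
    _ ≤ (M + b) * ε := by
        rw [add_mul]
        gcongr

end Nikolskii

/-! ### Nikolskii's inequality -/

section BlockBound

/-- Nikolskii's inequality for the dyadic blocks, with all exponents `0 < r < ∞`. -/
theorem exists_enorm_block_le (ψ : CutOff n) {r : ℝ} (hr : 0 < r) :
    ∃ C : ℝ≥0, ∀ (u : 𝓢'(EuclideanSpace ℝ (Fin n), ℂ)) (k : ℤ) (x : EuclideanSpace ℝ (Fin n)),
      ‖block ψ k u x‖ₑ ≤
        C * ((2 : ℝ≥0∞) ^ ((k : ℝ) * n) * ∫⁻ y, ‖block ψ k u y‖ₑ ^ r) ^ (1 / r) := by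
  set g := 𝓕 ψ.wideSchwartz with hg
  -- The added 1 keeps b nonzero, so that the right side is ∞ when the integral is.
  set b : ℝ≥0 := Real.toNNReal (SchwartzMap.seminorm ℂ 0 0 g) + 1 with hb
  have hgb : ∀ z, ‖g z‖ₑ ≤ b := fun z => by
    rw [← ofReal_norm, hb, ENNReal.coe_add]
    exact (ENNReal.ofReal_le_ofReal (g.norm_le_seminorm ℂ z)).trans le_self_add
  have hD : ∀ (k : ℤ) z, ‖𝓕 (dyadic k ψ.wideSchwartz) z‖ₑ ≤ (2 : ℝ≥0∞) ^ ((k : ℝ) * n) * b :=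
    fun k z => by
      rw [enorm_fourier_dyadic_apply, finrank_euclideanSpace_fin]
      gcongr
      exact hgb _
  have hrep : ∀ (u : 𝓢'(EuclideanSpace ℝ (Fin n), ℂ)) (k : ℤ) x, ‖block ψ k u x‖ₑ ≤
      ∫⁻ y, ‖𝓕 (dyadic k ψ.wideSchwartz) (y - x)‖ₑ * ‖block ψ k u y‖ₑ := fun u k x => by
    rw [block_eq_integral]
    refine (enorm_integral_le_lintegral_enorm _).trans_eq ?_
    simp_rw [enorm_mul]
  rcases le_total r 1 with hr1 | hr1
  · refine ⟨b ^ (1 / r), fun u k x => ?_⟩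
    set D := (2 : ℝ≥0∞) ^ ((k : ℝ) * n) with hDdef
    rcases eq_or_ne (∫⁻ y, ‖block ψ k u y‖ₑ ^ r) ⊤ with hI | hI
    · rw [hI, ENNReal.mul_top (two_rpow_ne_zero _), ENNReal.top_rpow_of_pos (by positivity),
        ENNReal.mul_top]
      · exact le_top
      · have : b ^ (1 / r) ≠ 0 := by simp [hb, NNReal.rpow_eq_zero_iff]
        exact_mod_cast this
    obtain ⟨N, A, hA, hgrow⟩ := exists_norm_block_le ψ k u
    have hgrow' : ∀ y, ‖block ψ k u y‖ₑ ≤ ENNReal.ofReal A * (1 + ‖y‖ₑ) ^ N := fun y => by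
      rw [← ofReal_norm, ← ofReal_norm, ← ENNReal.ofReal_one,
        ← ENNReal.ofReal_add zero_le_one (norm_nonneg _), ← ENNReal.ofReal_pow (by positivity),
        ← ENNReal.ofReal_mul hA]
      exact ENNReal.ofReal_le_ofReal (hgrow y)
    obtain ⟨B, hB, hBle⟩ := exists_one_add_pow_mul_iteratedFDeriv_le
      (𝓕 (dyadic k ψ.wideSchwartz)) N 0
    have hB' : ∀ z, ‖𝓕 (dyadic k ψ.wideSchwartz) z‖ₑ * (1 + ‖z‖ₑ) ^ N ≤ ENNReal.ofReal B :=
      fun z => by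
        rw [← ofReal_norm, ← ofReal_norm, ← ENNReal.ofReal_one,
          ← ENNReal.ofReal_add zero_le_one (norm_nonneg _), ← ENNReal.ofReal_pow (by positivity),
          ← ENNReal.ofReal_mul (norm_nonneg _), mul_comm]
        refine ENNReal.ofReal_le_ofReal ?_
        simpa using hBle z
    -- Two passes. The first uses the unknown growth order N and only shows that the block is
    -- bounded, with a useless constant. The second, with N = 0, needs only the sup of the kernel,
    -- so its constant is 2^{kn} b.
    have h1 : ∀ y, ‖block ψ k u y‖ₑ ≤
        (ENNReal.ofReal B * ∫⁻ y, ‖block ψ k u y‖ₑ ^ r) ^ (1 / r) * (1 + ‖y‖ₑ) ^ 0 := fun y => by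
      rw [pow_zero, mul_one, one_div, ENNReal.le_rpow_inv_iff hr]
      exact rpow_le_mul_lintegral_of_le_one hr hr1 ENNReal.ofReal_ne_top ENNReal.ofReal_ne_top
        hgrow' hB' (hrep u k) y
    have h2 := rpow_le_mul_lintegral_of_le_one (B := D * b) hr hr1
      (ENNReal.rpow_ne_top_of_nonneg (by positivity) (by finiteness))
      (ENNReal.mul_ne_top (two_rpow_ne_top _) ENNReal.coe_ne_top) h1
      (fun z => by simpa using hD k z) (hrep u k) x
    rw [← ENNReal.le_rpow_inv_iff hr, ← one_div, mul_comm D, mul_assoc,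
      ENNReal.mul_rpow_of_nonneg _ _ (by positivity)] at h2
    rwa [ENNReal.coe_rpow_of_nonneg _ (by positivity)]
  · have hM : ∫⁻ z, ‖g z‖ₑ ≠ ⊤ := g.integrable.2.ne
    refine ⟨(∫⁻ z, ‖g z‖ₑ).toNNReal + b, fun u k x => ?_⟩
    rw [ENNReal.coe_add, ENNReal.coe_toNNReal hM]
    refine le_mul_lintegral_of_one_le hr1 (by simp [hb]) (two_rpow_ne_zero _) (two_rpow_ne_top _)
      (continuous_block ψ k u).enorm.measurable (hD k)
      (lintegral_enorm_fourier_dyadic k _).le (hrep u k) x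

end BlockBound

/-! ### Summing a sequence with two geometric bounds -/

section Summation

theorem tsum_two_rpow_neg_mul_abs_ne_top {γ : ℝ} (hγ : 0 < γ) :
    ∑' k : ℤ, (2 : ℝ≥0∞) ^ (-γ * |(k : ℝ)|) ≠ ⊤ := by
  have h0 : 0 ≤ (2 : ℝ) ^ (-γ) := by positivity
  have h1 : (2 : ℝ) ^ (-γ) < 1 := Real.rpow_lt_one_of_one_lt_of_neg one_lt_two (by linarith)
  have hg := summable_geometric_of_lt_one h0 h1
  have hs : Summable fun k : ℤ => (2 : ℝ) ^ (-γ * |(k : ℝ)|) := by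
    refine Summable.of_nat_of_neg ?_ ?_ <;>
    · refine hg.congr fun m => ?_
      rw [← Real.rpow_natCast, ← Real.rpow_mul zero_le_two]
      simp
  have := hs.tsum_ofReal_ne_top
  refine ne_of_eq_of_ne (tsum_congr fun k => ?_) this
  rw [← ENNReal.ofReal_rpow_of_pos two_pos, ENNReal.ofReal_ofNat]

theorem exists_eq_two_rpow {X : ℝ≥0∞} (h0 : X ≠ 0) (ht : X ≠ ⊤) :
    ∃ x : ℝ, X = (2 : ℝ≥0∞) ^ x := by
  refine ⟨Real.logb 2 X.toReal, ?_⟩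
  rw [← ENNReal.ofReal_ofNat 2, ENNReal.ofReal_rpow_of_pos two_pos,
    Real.rpow_logb two_pos (by norm_num) (ENNReal.toReal_pos h0 ht), ENNReal.ofReal_toReal ht]

/-- A two-sided geometric bound for a sequence gives a multiplicative bound for its
`ℓ^q`-quasinorm. -/
theorem exists_tsum_rpow_le {α β q : ℝ} (hα : 0 < α) (hβ : 0 < β) (hq : 0 < q) :
    ∃ C : ℝ≥0, ∀ (X Y : ℝ≥0∞) (a : ℤ → ℝ≥0∞), X ≠ ⊤ → Y ≠ ⊤ →
      (∀ k : ℤ, a k ≤ 2 ^ ((k : ℝ) * α) * X) → (∀ k : ℤ, a k ≤ 2 ^ (-((k : ℝ) * β)) * Y) →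
      (∑' k, a k ^ q) ^ (1 / q) ≤ C * X ^ (β / (α + β)) * Y ^ (α / (α + β)) := by
  set γ := min α β with hγ
  have hγ0 : 0 < γ := lt_min hα hβ
  have hqγ : 0 < q * γ := mul_pos hq hγ0
  have hT := tsum_two_rpow_neg_mul_abs_ne_top hqγ
  set T := ∑' k : ℤ, (2 : ℝ≥0∞) ^ (-(q * γ) * |(k : ℝ)|) with hTdef
  have hCt : (2 : ℝ≥0∞) ^ γ * T ^ (1 / q) ≠ ⊤ :=
    ENNReal.mul_ne_top (two_rpow_ne_top _) (ENNReal.rpow_ne_top_of_nonneg (by positivity) hT)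
  refine ⟨((2 : ℝ≥0∞) ^ γ * T ^ (1 / q)).toNNReal, fun X Y a hXt hYt hX hY => ?_⟩
  rw [ENNReal.coe_toNNReal hCt]
  by_cases h0 : X = 0 ∨ Y = 0
  · have ha : ∀ k, a k = 0 := fun k => by
      rcases h0 with h | h
      · simpa [h] using hX k
      · simpa [h] using hY k
    simp [ha, hq]
  push Not at h0
  obtain ⟨x, rfl⟩ := exists_eq_two_rpow h0.1 hXt
  obtain ⟨y, rfl⟩ := exists_eq_two_rpow h0.2 hYt
  have hαβ : α + β ≠ 0 := by positivity
  -- The exponents kα + x and y - kβ meet at k = t with common value z, which is the exponent of the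
  -- claimed product. Rounding t to the integer m costs the factor 2^γ.
  set t := (y - x) / (α + β) with ht
  set z := x * (β / (α + β)) + y * (α / (α + β)) with hz
  set m := ⌊t⌋ with hm
  have hbound : ∀ k : ℤ, a k ^ q ≤
      2 ^ ((z + γ) * q) * 2 ^ (-(q * γ) * |((k - m : ℤ) : ℝ)|) := fun k => by
    have h1 : (k : ℝ) * α + x = (k - t) * α + z := by
      rw [ht, hz]; field_simp; ring
    have h2 : -((k : ℝ) * β) + y = -((k - t) * β) + z := by
      rw [ht, hz]; field_simp; ring
    have hX' := hX k
    have hY' := hY k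
    rw [← two_rpow_add, h1] at hX'
    rw [← two_rpow_add, h2] at hY'
    have hkm : |((k - m : ℤ) : ℝ)| ≤ |k - t| + 1 := by
      have e : ((k - m : ℤ) : ℝ) = (k - t) + (t - m) := by push_cast; ring
      rw [e]
      refine (abs_add_le _ _).trans ?_
      gcongr
      rw [abs_of_nonneg (by linarith [Int.floor_le t])]
      linarith [Int.lt_floor_add_one t]
    have ha : a k ≤ 2 ^ (z + γ - γ * |((k - m : ℤ) : ℝ)|) := by
      have hγkm : γ * |((k - m : ℤ) : ℝ)| ≤ γ * |k - t| + γ := by nlinarith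
      rcases le_total 0 ((k : ℝ) - t) with h | h
      · refine hY'.trans (ENNReal.rpow_le_rpow_of_exponent_le (by norm_num) ?_)
        rw [abs_of_nonneg h] at hγkm
        nlinarith [mul_le_mul_of_nonneg_right (min_le_right α β) h]
      · refine hX'.trans (ENNReal.rpow_le_rpow_of_exponent_le (by norm_num) ?_)
        rw [abs_of_nonpos h] at hγkm
        nlinarith [mul_le_mul_of_nonneg_right (min_le_left α β) (neg_nonneg.2 h)]
    refine (ENNReal.rpow_le_rpow ha hq.le).trans_eq ?_
    rw [← ENNReal.rpow_mul, ← two_rpow_add]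
    congr 1
    ring
  calc (∑' k, a k ^ q) ^ (1 / q)
      ≤ (∑' k : ℤ, 2 ^ ((z + γ) * q) * 2 ^ (-(q * γ) * |((k - m : ℤ) : ℝ)|)) ^ (1 / q) := by
        gcongr with k
        exact hbound k
    _ = (2 ^ ((z + γ) * q) * T) ^ (1 / q) := by
        rw [ENNReal.tsum_mul_left]
        congr 2
        exact (Equiv.subRight m).tsum_eq fun k : ℤ => (2 : ℝ≥0∞) ^ (-(q * γ) * |(k : ℝ)|)
    _ = 2 ^ γ * T ^ (1 / q) * 2 ^ z := by
        rw [ENNReal.mul_rpow_of_nonneg _ _ (by positivity), ← ENNReal.rpow_mul, mul_assoc,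
          mul_one_div_cancel hq.ne', mul_one, two_rpow_add]
        ring
    _ = _ := by rw [hz, two_rpow_add, ENNReal.rpow_mul, ENNReal.rpow_mul]; ring

end Summation

/-! ### The interpolation inequality and the Sobolev embedding -/

section Norms

theorem squareFun_top (ψ : CutOff n) (s : ℝ) (u : 𝓢'(EuclideanSpace ℝ (Fin n), ℂ))
    (x : EuclideanSpace ℝ (Fin n)) :
    squareFun ψ s ⊤ u x = ⨆ k : ℤ, (2 : ℝ≥0∞) ^ ((k : ℝ) * s) * ‖block ψ k u x‖ₑ :=
  if_pos rfl

theorem squareFun_ofReal (ψ : CutOff n) (s : ℝ) {q : ℝ} (hq : 0 < q)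
    (u : 𝓢'(EuclideanSpace ℝ (Fin n), ℂ)) (x : EuclideanSpace ℝ (Fin n)) :
    squareFun ψ s (ENNReal.ofReal q) u x =
      (∑' k : ℤ, ((2 : ℝ≥0∞) ^ ((k : ℝ) * s) * ‖block ψ k u x‖ₑ) ^ q) ^ (1 / q) := by
  rw [squareFun, if_neg ENNReal.ofReal_ne_top, ENNReal.toReal_ofReal hq.le]

theorem le_squareFun_top (ψ : CutOff n) (s : ℝ) (u : 𝓢'(EuclideanSpace ℝ (Fin n), ℂ))
    (x : EuclideanSpace ℝ (Fin n)) (k : ℤ) :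
    (2 : ℝ≥0∞) ^ ((k : ℝ) * s) * ‖block ψ k u x‖ₑ ≤ squareFun ψ s ⊤ u x := by
  rw [squareFun_top]
  exact le_iSup (fun k : ℤ => (2 : ℝ≥0∞) ^ ((k : ℝ) * s) * ‖block ψ k u x‖ₑ) k

theorem two_rpow_mul_le_squareFun_top (ψ : CutOff n) (s t : ℝ)
    (u : 𝓢'(EuclideanSpace ℝ (Fin n), ℂ)) (x : EuclideanSpace ℝ (Fin n)) (k : ℤ) :
    (2 : ℝ≥0∞) ^ ((k : ℝ) * s) * ‖block ψ k u x‖ₑ ≤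
      2 ^ ((k : ℝ) * (s - t)) * squareFun ψ t ⊤ u x := by
  have h : (k : ℝ) * s = k * (s - t) + k * t := by ring
  rw [h, two_rpow_add, mul_assoc]
  gcongr
  exact le_squareFun_top ψ t u x k

theorem measurable_squareFun_top (ψ : CutOff n) (s : ℝ)
    (u : 𝓢'(EuclideanSpace ℝ (Fin n), ℂ)) : Measurable (squareFun ψ s ⊤ u) := by
  rw [funext (squareFun_top ψ s u)]
  exact Measurable.iSup fun k => (continuous_block ψ k u).enorm.measurable.const_mul _

theorem ae_squareFun_top_ne_top (ψ : CutOff n) {s p : ℝ} (hp : 0 < p)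
    {u : 𝓢'(EuclideanSpace ℝ (Fin n), ℂ)} (h : tlNorm ψ s p ⊤ u ≠ ⊤) :
    ∀ᵐ x, squareFun ψ s ⊤ u x ≠ ⊤ := by
  have h1 : ∫⁻ x, squareFun ψ s ⊤ u x ^ p ≠ ⊤ := fun h1 => h (by
    rw [tlNorm, h1, ENNReal.top_rpow_of_pos (by positivity)])
  filter_upwards [ae_lt_top ((measurable_squareFun_top ψ s u).pow_const p) h1] with x hx hxt
  rw [hxt, ENNReal.top_rpow_of_pos hp] at hx
  exact lt_irrefl _ hx

/-- Hölder's inequality for a function bounded by a geometric mean. -/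
theorem lintegral_rpow_le_of_le_geom_mean {X : Type*} [MeasurableSpace X] {μ : Measure X}
    {r p₀ p₁ θ : ℝ} (hp₀ : 0 < p₀) (hp₁ : 0 < p₁) (hθ₀ : 0 < θ) (hθ₁ : θ < 1)
    (hr : 1 / r = (1 - θ) / p₀ + θ / p₁) {C : ℝ≥0∞} (hC : C ≠ ⊤) {f g₀ g₁ : X → ℝ≥0∞}
    (hg₀ : Measurable g₀) (hg₁ : Measurable g₁)
    (hf : ∀ᵐ x ∂μ, f x ≤ C * g₀ x ^ (1 - θ) * g₁ x ^ θ) :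
    (∫⁻ x, f x ^ r ∂μ) ^ (1 / r) ≤ C * ((∫⁻ x, g₀ x ^ p₀ ∂μ) ^ (1 / p₀)) ^ (1 - θ) *
      ((∫⁻ x, g₁ x ^ p₁ ∂μ) ^ (1 / p₁)) ^ θ := by
  have hθ' : 0 < 1 - θ := by linarith
  have hr0 : 0 < r := by
    rw [← one_div_pos, hr]
    positivity
  have hrq : r < p₀ / (1 - θ) := by
    rw [← one_div_lt_one_div (by positivity) hr0, one_div_div, hr]
    have : 0 < θ / p₁ := by positivity
    linarith
  have hol := ENNReal.lintegral_Lp_mul_le_Lq_mul_Lr (q := p₀ / (1 - θ)) (r := p₁ / θ) hr0 hrq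
    (by rw [one_div_div, one_div_div, hr]) μ (f := fun x => g₀ x ^ (1 - θ))
    (g := fun x => g₁ x ^ θ) (hg₀.pow_const _).aemeasurable (hg₁.pow_const _).aemeasurable
  simp only [← ENNReal.rpow_mul, mul_div_cancel₀ _ hθ'.ne', mul_div_cancel₀ _ hθ₀.ne',
    one_div_div, Pi.mul_apply] at hol
  calc (∫⁻ x, f x ^ r ∂μ) ^ (1 / r)
      ≤ (∫⁻ x, C ^ r * (g₀ x ^ (1 - θ) * g₁ x ^ θ) ^ r ∂μ) ^ (1 / r) := by
        refine ENNReal.rpow_le_rpow (lintegral_mono_ae ?_) (by positivity)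
        filter_upwards [hf] with x hx
        rw [← ENNReal.mul_rpow_of_nonneg _ _ hr0.le, ← mul_assoc]
        gcongr
    _ = C * (∫⁻ x, (g₀ x ^ (1 - θ) * g₁ x ^ θ) ^ r ∂μ) ^ (1 / r) := by
        rw [lintegral_const_mul' _ _ (ENNReal.rpow_ne_top_of_nonneg hr0.le hC),
          ENNReal.mul_rpow_of_nonneg _ _ (by positivity), ← ENNReal.rpow_mul,
          mul_one_div_cancel hr0.ne', ENNReal.rpow_one]
    _ ≤ _ := by
        rw [mul_assoc]
        gcongr
        refine hol.trans_eq ?_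
        rw [← ENNReal.rpow_mul, ← ENNReal.rpow_mul, one_div_mul_eq_div, one_div_mul_eq_div]

/-- Each term is exactly a geometric mean of the corresponding terms, so for a supremum no gap
between s₀ and s₁ is needed. -/
theorem squareFun_top_le_geom_mean (ψ : CutOff n) (s₀ s₁ : ℝ) {θ : ℝ} (hθ₀ : 0 < θ)
    (hθ₁ : θ < 1) (u : 𝓢'(EuclideanSpace ℝ (Fin n), ℂ)) (x : EuclideanSpace ℝ (Fin n)) :
    squareFun ψ ((1 - θ) * s₀ + θ * s₁) ⊤ u x ≤
      squareFun ψ s₀ ⊤ u x ^ (1 - θ) * squareFun ψ s₁ ⊤ u x ^ θ := by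
  have hθ' : 0 < 1 - θ := by linarith
  rw [squareFun_top]
  refine iSup_le fun k => ?_
  have h : (2 : ℝ≥0∞) ^ ((k : ℝ) * ((1 - θ) * s₀ + θ * s₁)) * ‖block ψ k u x‖ₑ =
      (2 ^ ((k : ℝ) * s₀) * ‖block ψ k u x‖ₑ) ^ (1 - θ) *
        (2 ^ ((k : ℝ) * s₁) * ‖block ψ k u x‖ₑ) ^ θ := by
    rw [ENNReal.mul_rpow_of_nonneg _ _ hθ'.le, ENNReal.mul_rpow_of_nonneg _ _ hθ₀.le,
      mul_mul_mul_comm, ← ENNReal.rpow_mul, ← ENNReal.rpow_mul, ← two_rpow_add,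
      ← ENNReal.rpow_add_of_nonneg _ _ hθ'.le hθ₀.le, sub_add_cancel, ENNReal.rpow_one]
    congr 2
    ring
  rw [h]
  gcongr <;> exact le_squareFun_top ψ _ u x k

/-- The Gagliardo–Nirenberg inequality between two spaces of distinct smoothness. -/
theorem exists_tlNorm_le_of_ne (ψ : CutOff n) {p p₀ p₁ q s₀ s₁ θ : ℝ}
    (hp₀ : 0 < p₀) (hp₁ : 0 < p₁) (hq : 0 < q) (hθ₀ : 0 < θ) (hθ₁ : θ < 1)
    (hp : 1 / p = (1 - θ) / p₀ + θ / p₁) (hs : s₀ ≠ s₁) :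
    ∃ C : ℝ≥0, ∀ u ∈ tlSpace ψ s₀ p₀ ⊤ ∩ tlSpace ψ s₁ p₁ ⊤,
      tlNorm ψ ((1 - θ) * s₀ + θ * s₁) p (ENNReal.ofReal q) u ≤
        C * tlNorm ψ s₀ p₀ ⊤ u ^ (1 - θ) * tlNorm ψ s₁ p₁ ⊤ u ^ θ := by
  have hθ' : 0 < 1 - θ := by linarith
  have key : ∃ C : ℝ≥0, ∀ (u : 𝓢'(EuclideanSpace ℝ (Fin n), ℂ)) (x : EuclideanSpace ℝ (Fin n)),
      squareFun ψ s₀ ⊤ u x ≠ ⊤ → squareFun ψ s₁ ⊤ u x ≠ ⊤ →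
      squareFun ψ ((1 - θ) * s₀ + θ * s₁) (ENNReal.ofReal q) u x ≤
        C * squareFun ψ s₀ ⊤ u x ^ (1 - θ) * squareFun ψ s₁ ⊤ u x ^ θ := by
    -- Since s - s₀ = θ(s₁ - s₀) and s - s₁ = -(1-θ)(s₁ - s₀), the rates are θ|s₁ - s₀| and (1-θ)|s₁
    -- - s₀|; the sign decides which bound governs low frequencies.
    rcases lt_or_gt_of_ne hs with h | h
    · have hd : 0 < s₁ - s₀ := by linarith
      obtain ⟨C, hC⟩ := exists_tsum_rpow_le (mul_pos hθ₀ hd) (mul_pos hθ' hd) hq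
      refine ⟨C, fun u x h0 h1 => ?_⟩
      rw [squareFun_ofReal ψ _ hq]
      have := hC _ _ (fun k : ℤ => (2 : ℝ≥0∞) ^ ((k : ℝ) * ((1 - θ) * s₀ + θ * s₁)) *
        ‖block ψ k u x‖ₑ) h0 h1
        (fun k => (two_rpow_mul_le_squareFun_top ψ _ s₀ u x k).trans_eq (by congr 2; ring))
        (fun k => (two_rpow_mul_le_squareFun_top ψ _ s₁ u x k).trans_eq (by congr 2; ring))
      convert this using 4
      · field_simp; ring
      · field_simp; ring
    · have hd : 0 < s₀ - s₁ := by linarith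
      obtain ⟨C, hC⟩ := exists_tsum_rpow_le (mul_pos hθ' hd) (mul_pos hθ₀ hd) hq
      refine ⟨C, fun u x h0 h1 => ?_⟩
      rw [squareFun_ofReal ψ _ hq, mul_right_comm]
      have := hC _ _ (fun k : ℤ => (2 : ℝ≥0∞) ^ ((k : ℝ) * ((1 - θ) * s₀ + θ * s₁)) *
        ‖block ψ k u x‖ₑ) h1 h0
        (fun k => (two_rpow_mul_le_squareFun_top ψ _ s₁ u x k).trans_eq (by congr 2; ring))
        (fun k => (two_rpow_mul_le_squareFun_top ψ _ s₀ u x k).trans_eq (by congr 2; ring))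
      convert this using 4
      · field_simp; ring
      · field_simp; ring
  obtain ⟨C, hC⟩ := key
  refine ⟨C, fun u hu => ?_⟩
  refine lintegral_rpow_le_of_le_geom_mean hp₀ hp₁ hθ₀ hθ₁ hp ENNReal.coe_ne_top
    (measurable_squareFun_top ψ s₀ u) (measurable_squareFun_top ψ s₁ u) ?_
  filter_upwards [ae_squareFun_top_ne_top ψ hp₀ hu.1.ne, ae_squareFun_top_ne_top ψ hp₁ hu.2.ne]
    with x h0 h1 using hC u x h0 h1

/-- The Sobolev-type embedding of `F^t_{r,∞}` into `F^s_{p,q}`, for `s < t`. -/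
theorem exists_tlNorm_le_of_lt (hn : 1 ≤ n) (ψ : CutOff n) {p q r s t : ℝ} (hp : 0 < p)
    (hr : 0 < r) (hq : 0 < q) (hst : s < t) (h : (n : ℝ) / p - s = n / r - t) :
    ∃ C : ℝ≥0, ∀ u, tlNorm ψ t r ⊤ u ≠ ⊤ →
      tlNorm ψ s p (ENNReal.ofReal q) u ≤ C * tlNorm ψ t r ⊤ u := by
  have hn' : (0 : ℝ) < n := by exact_mod_cast hn
  have hα : 0 < (n : ℝ) / p := by positivity
  have hβ : 0 < t - s := by linarith
  obtain ⟨C₁, hC₁⟩ := exists_enorm_block_le ψ hr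
  obtain ⟨C₂, hC₂⟩ := exists_tsum_rpow_le hα hβ hq
  have hsum : (n : ℝ) / p + (t - s) = n / r := by linarith
  -- The dimension condition makes the exponent of the square function r / p, so its p-th power is
  -- the integrand of the norm on F^t_{r,∞}.
  have hexp : (n : ℝ) / p / (n / p + (t - s)) = r / p := by
    rw [hsum]; field_simp
  have hrp : r / p + (t - s) / (n / p + (t - s)) = 1 := by
    rw [← hexp, ← add_div, div_self (by positivity)]
  set η := (t - s) / (n / p + (t - s)) with hη
  have hη0 : 0 < η := by positivity
  refine ⟨C₂ * C₁ ^ η, fun u hu => ?_⟩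
  set A := tlNorm ψ t r ⊤ u with hA
  -- The low-frequency bound, uniform in x: Nikolskii applied to each block, whose L^r norm is at
  -- most 2^{-kt} A.
  have hb : ∀ (k : ℤ) x, (2 : ℝ≥0∞) ^ ((k : ℝ) * s) * ‖block ψ k u x‖ₑ ≤
      2 ^ ((k : ℝ) * (n / p)) * (C₁ * A) := fun k x => by
    have h1 : ∫⁻ y, ‖block ψ k u y‖ₑ ^ r ≤
        2 ^ (-((k : ℝ) * t) * r) * ∫⁻ y, squareFun ψ t ⊤ u y ^ r := by
      rw [← lintegral_const_mul _ ((measurable_squareFun_top ψ t u).pow_const r)]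
      refine lintegral_mono fun y => ?_
      rw [ENNReal.rpow_mul, ← ENNReal.mul_rpow_of_nonneg _ _ hr.le]
      gcongr
      calc ‖block ψ k u y‖ₑ = (2 : ℝ≥0∞) ^ ((k : ℝ) * 0) * ‖block ψ k u y‖ₑ := by simp
        _ ≤ _ := two_rpow_mul_le_squareFun_top ψ 0 t u y k
        _ = _ := by congr 2; ring
    calc (2 : ℝ≥0∞) ^ ((k : ℝ) * s) * ‖block ψ k u x‖ₑ
        ≤ 2 ^ ((k : ℝ) * s) * (C₁ * (2 ^ ((k : ℝ) * n) * (2 ^ (-((k : ℝ) * t) * r) *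
            ∫⁻ y, squareFun ψ t ⊤ u y ^ r)) ^ (1 / r)) := by
          gcongr
          refine (hC₁ u k x).trans ?_
          gcongr
      _ = 2 ^ ((k : ℝ) * s) * (C₁ * (2 ^ ((k : ℝ) * n / r - k * t) * A)) := by
          rw [← mul_assoc ((2 : ℝ≥0∞) ^ _) ((2 : ℝ≥0∞) ^ _) (lintegral _ _), ← two_rpow_add,
            ENNReal.mul_rpow_of_nonneg _ _ (by positivity),
            ← ENNReal.rpow_mul, hA, tlNorm]
          congr 4
          field_simp
          ring
      _ = (2 ^ ((k : ℝ) * s) * 2 ^ ((k : ℝ) * n / r - k * t)) * (C₁ * A) := by ring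
      _ = _ := by
          rw [← two_rpow_add]
          congr 2
          have : (n : ℝ) / p = n / r - t + s := by linarith
          rw [this]; ring
  have hpt : ∀ᵐ x, squareFun ψ s (ENNReal.ofReal q) u x ≤
      C₂ * (C₁ * A) ^ η * squareFun ψ t ⊤ u x ^ (r / p) := by
    filter_upwards [ae_squareFun_top_ne_top ψ hr hu] with x hx
    rw [squareFun_ofReal ψ _ hq, ← hexp]
    exact hC₂ _ _ _ (ENNReal.mul_ne_top ENNReal.coe_ne_top hu) hx (fun k => hb k x)
      fun k => (two_rpow_mul_le_squareFun_top ψ s t u x k).trans_eq (by congr 2; ring)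
  have hct : (C₂ : ℝ≥0∞) * (C₁ * A) ^ η ≠ ⊤ := ENNReal.mul_ne_top ENNReal.coe_ne_top
    (ENNReal.rpow_ne_top_of_nonneg hη0.le (ENNReal.mul_ne_top ENNReal.coe_ne_top hu))
  calc tlNorm ψ s p (ENNReal.ofReal q) u
      ≤ (∫⁻ x, (C₂ * (C₁ * A) ^ η) ^ p * squareFun ψ t ⊤ u x ^ r) ^ (1 / p) := by
        refine ENNReal.rpow_le_rpow (lintegral_mono_ae ?_) (by positivity)
        filter_upwards [hpt] with x hx
        refine (ENNReal.rpow_le_rpow hx hp.le).trans_eq ?_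
        rw [ENNReal.mul_rpow_of_nonneg _ _ hp.le, ← ENNReal.rpow_mul (squareFun _ _ _ _ _),
          div_mul_cancel₀ _ hp.ne']
    _ = C₂ * (C₁ * A) ^ η * (∫⁻ x, squareFun ψ t ⊤ u x ^ r) ^ (1 / p) := by
        rw [lintegral_const_mul' _ _ (ENNReal.rpow_ne_top_of_nonneg hp.le hct),
          ENNReal.mul_rpow_of_nonneg _ _ (by positivity), ← ENNReal.rpow_mul,
          mul_one_div_cancel hp.ne', ENNReal.rpow_one]
    _ = C₂ * (C₁ * A) ^ η * A ^ (r / p) := by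
        rw [hA, tlNorm, ← ENNReal.rpow_mul]
        congr 2
        field_simp
    _ = ((C₂ * C₁ ^ η : ℝ≥0) : ℝ≥0∞) * A := by
        rw [ENNReal.mul_rpow_of_nonneg _ _ hη0.le, ENNReal.coe_mul,
          ← ENNReal.coe_rpow_of_nonneg _ hη0.le, mul_assoc, mul_assoc, mul_assoc,
          ← ENNReal.rpow_add_of_nonneg _ _ hη0.le (by positivity), add_comm, hrp,
          ENNReal.rpow_one]

/-- The three conditions are sufficient for the Gagliardo–Nirenberg inequality. -/
theorem exists_tlNorm_le_of_conditions (hn : 1 ≤ n) (ψ : CutOff n)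
    {p p₀ p₁ q s s₀ s₁ θ : ℝ} (hp : 0 < p) (hp₀ : 0 < p₀) (hp₁ : 0 < p₁) (hq : 0 < q)
    (hθ₀ : 0 < θ) (hθ₁ : θ < 1)
    (hdim : (n : ℝ) / p - s = (1 - θ) * ((n : ℝ) / p₀ - s₀) + θ * ((n : ℝ) / p₁ - s₁))
    (hle : s ≤ (1 - θ) * s₀ + θ * s₁) (hne : s = (1 - θ) * s₀ + θ * s₁ → s₀ ≠ s₁) :
    ∃ C : ℝ≥0, ∀ u ∈ tlSpace ψ s₀ p₀ ⊤ ∩ tlSpace ψ s₁ p₁ ⊤,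
      tlNorm ψ s p (ENNReal.ofReal q) u ≤
        C * tlNorm ψ s₀ p₀ ⊤ u ^ (1 - θ) * tlNorm ψ s₁ p₁ ⊤ u ^ θ := by
  have hn' : (0 : ℝ) < n := by exact_mod_cast hn
  have hθ' : 0 < 1 - θ := by linarith
  rcases hle.eq_or_lt with heq | hlt
  · subst heq
    refine exists_tlNorm_le_of_ne ψ hp₀ hp₁ hq hθ₀ hθ₁ ?_ (hne rfl)
    have h : (n : ℝ) / p = (1 - θ) * (n / p₀) + θ * (n / p₁) := by linarith
    have h2 : (n : ℝ) * (1 / p) = n * ((1 - θ) / p₀ + θ / p₁) := by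
      calc (n : ℝ) * (1 / p) = n / p := by ring
        _ = _ := h
        _ = _ := by ring
    exact mul_left_cancel₀ hn'.ne' h2
  -- The intermediate space has the smoothness and the integrability that Hölder gives; condition 1
  -- then says that the embedding is dimensionally correct.
  · set r := ((1 - θ) / p₀ + θ / p₁)⁻¹ with hr
    have hr0 : 0 < r := by positivity
    have hr1 : 1 / r = (1 - θ) / p₀ + θ / p₁ := by rw [hr, one_div, inv_inv]
    have hnr : (n : ℝ) / r = (1 - θ) * (n / p₀) + θ * (n / p₁) := by
      rw [div_eq_mul_one_div, hr1]; ring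
    obtain ⟨C, hC⟩ := exists_tlNorm_le_of_lt hn ψ hp hr0 hq hlt (by rw [hnr, hdim]; ring)
    refine ⟨C, fun u hu => ?_⟩
    have h1 : tlNorm ψ ((1 - θ) * s₀ + θ * s₁) r ⊤ u ≤
        1 * tlNorm ψ s₀ p₀ ⊤ u ^ (1 - θ) * tlNorm ψ s₁ p₁ ⊤ u ^ θ :=
      lintegral_rpow_le_of_le_geom_mean hp₀ hp₁ hθ₀ hθ₁ hr1 ENNReal.one_ne_top
        (measurable_squareFun_top ψ s₀ u) (measurable_squareFun_top ψ s₁ u)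
        (Filter.Eventually.of_forall fun x => by
          rw [one_mul]
          exact squareFun_top_le_geom_mean ψ s₀ s₁ hθ₀ hθ₁ u x)
    rw [one_mul] at h1
    have ht : tlNorm ψ ((1 - θ) * s₀ + θ * s₁) r ⊤ u ≠ ⊤ :=
      ne_top_of_le_ne_top (ENNReal.mul_ne_top (ENNReal.rpow_ne_top_of_nonneg hθ'.le hu.1.ne)
        (ENNReal.rpow_ne_top_of_nonneg hθ₀.le hu.2.ne)) h1
    refine (hC u ht).trans ?_
    rw [mul_assoc]
    gcongr

end Norms

/-! ### Linearity and scaling of blocks and norms -/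

section BlockAlgebra

theorem block_add (ψ : CutOff n) (k : ℤ) (u v : 𝓢'(EuclideanSpace ℝ (Fin n), ℂ))
    (x : EuclideanSpace ℝ (Fin n)) :
    block ψ k (u + v) x = block ψ k u x + block ψ k v x := by
  simp only [block_eq]
  rfl

theorem block_smul (ψ : CutOff n) (k : ℤ) (c : ℂ) (u : 𝓢'(EuclideanSpace ℝ (Fin n), ℂ))
    (x : EuclideanSpace ℝ (Fin n)) :
    block ψ k (c • u) x = c * block ψ k u x := by
  simp only [block_eq]
  rfl

theorem block_sum (ψ : CutOff n) (k : ℤ) {ι : Type*} (A : Finset ι)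
    (u : ι → 𝓢'(EuclideanSpace ℝ (Fin n), ℂ)) (x : EuclideanSpace ℝ (Fin n)) :
    block ψ k (∑ j ∈ A, u j) x = ∑ j ∈ A, block ψ k (u j) x := by
  classical
  induction A using Finset.induction_on with
  | empty =>
    simp only [Finset.sum_empty, block_eq]
    rfl
  | insert a A ha ih => rw [Finset.sum_insert ha, Finset.sum_insert ha, block_add, ih]

theorem block_fourierInv (ψ : CutOff n) (l : ℤ) (F : 𝓢(EuclideanSpace ℝ (Fin n), ℂ))
    (x : EuclideanSpace ℝ (Fin n)) :
    block ψ l ((𝓕⁻ F : 𝓢(EuclideanSpace ℝ (Fin n), ℂ)) : 𝓢'(EuclideanSpace ℝ (Fin n), ℂ)) x =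
      ∫ v, Complex.exp (↑(2 * Real.pi * inner ℝ v x) * Complex.I) * (ψ.phiK l v * F v) := by
  rw [block_coe, Real.fourierInv_eq']
  have h : ∀ v, 𝓕 (⇑(𝓕⁻ F : 𝓢(EuclideanSpace ℝ (Fin n), ℂ))) v = F v := fun v => by
    rw [← SchwartzMap.fourier_coe, FourierInvPair.fourier_fourierInv_eq]
  simp_rw [h, smul_eq_mul]

/-- Dilating the frequency variable by 2ᵐ turns φ_l into φ_{l-m}. Shifting the index in the sum or
supremum then gives exact scaling of the norms. -/
theorem block_fourierInv_dyadic (ψ : CutOff n) (l m : ℤ) (F : 𝓢(EuclideanSpace ℝ (Fin n), ℂ))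
    (x : EuclideanSpace ℝ (Fin n)) :
    block ψ l ((𝓕⁻ (dyadic m F) : 𝓢(EuclideanSpace ℝ (Fin n), ℂ)) :
        𝓢'(EuclideanSpace ℝ (Fin n), ℂ)) x =
      ((((2 : ℝ) ^ m) ^ n : ℝ) : ℂ) * block ψ (l - m) ((𝓕⁻ F : 𝓢(EuclideanSpace ℝ (Fin n), ℂ)) :
        𝓢'(EuclideanSpace ℝ (Fin n), ℂ)) ((2 : ℝ) ^ m • x) := by
  rw [block_fourierInv, block_fourierInv]
  have h := Measure.integral_comp_smul (volume : Measure (EuclideanSpace ℝ (Fin n))) (fun v =>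
    Complex.exp (↑(2 * Real.pi * inner ℝ v ((2 : ℝ) ^ m • x)) * Complex.I) *
      (ψ.phiK (l - m) v * F v)) ((2 : ℝ) ^ (-m))
  have h2 : |(((2 : ℝ) ^ (-m)) ^ Module.finrank ℝ (EuclideanSpace ℝ (Fin n)))⁻¹| =
      ((2 : ℝ) ^ m) ^ n := by
    rw [abs_of_pos (by positivity), ← inv_pow, zpow_neg, inv_inv, finrank_euclideanSpace_fin]
  rw [h2, Complex.real_smul] at h
  rw [← h]
  refine integral_congr_ae (Filter.Eventually.of_forall fun v => ?_)
  have h3 : (2 : ℝ) ^ (-(l - m)) * (2 : ℝ) ^ (-m) = 2 ^ (-l) := by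
    rw [← zpow_add₀ two_ne_zero]; congr 1; ring
  simp only [dyadic_apply, inner_smul_left, inner_smul_right, conj_trivial, CutOff.phiK,
    smul_smul, h3]
  congr 5
  rw [← mul_assoc, ← zpow_add₀ two_ne_zero, add_neg_cancel, zpow_zero, one_mul]

theorem squareFun_fourierInv_dyadic (ψ : CutOff n) (s : ℝ) (q : ℝ≥0∞) (hq : 0 < q) (m : ℤ)
    (F : 𝓢(EuclideanSpace ℝ (Fin n), ℂ)) (x : EuclideanSpace ℝ (Fin n)) :
    squareFun ψ s q ((𝓕⁻ (dyadic m F) : 𝓢(EuclideanSpace ℝ (Fin n), ℂ)) :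
        𝓢'(EuclideanSpace ℝ (Fin n), ℂ)) x =
      2 ^ ((m : ℝ) * (n + s)) * squareFun ψ s q ((𝓕⁻ F : 𝓢(EuclideanSpace ℝ (Fin n), ℂ)) :
        𝓢'(EuclideanSpace ℝ (Fin n), ℂ)) ((2 : ℝ) ^ m • x) := by
  set u : 𝓢'(EuclideanSpace ℝ (Fin n), ℂ) := ((𝓕⁻ F : 𝓢(EuclideanSpace ℝ (Fin n), ℂ)) :
        𝓢'(EuclideanSpace ℝ (Fin n), ℂ)) with hu
  have h : ∀ l : ℤ, (2 : ℝ≥0∞) ^ ((l : ℝ) * s) *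
      ‖block ψ l ((𝓕⁻ (dyadic m F) : 𝓢(EuclideanSpace ℝ (Fin n), ℂ)) :
        𝓢'(EuclideanSpace ℝ (Fin n), ℂ)) x‖ₑ = 2 ^ ((m : ℝ) * (n + s)) *
      (2 ^ (((l - m : ℤ) : ℝ) * s) * ‖block ψ (l - m) u ((2 : ℝ) ^ m • x)‖ₑ) := fun l => by
    rw [block_fourierInv_dyadic, enorm_mul, ← mul_assoc, ← mul_assoc, ← two_rpow_add]
    congr 1
    rw [← ofReal_norm, Complex.norm_real, Real.norm_of_nonneg (by positivity),
      ofReal_two_zpow_pow, ← two_rpow_add]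
    congr 1
    push_cast
    ring
  simp only [squareFun]
  split_ifs with hqt
  · simp_rw [h]
    rw [← ENNReal.mul_iSup]
    congr 1
    exact (Equiv.subRight m).iSup_comp
      (g := fun l : ℤ => (2 : ℝ≥0∞) ^ ((l : ℝ) * s) * ‖block ψ l u ((2 : ℝ) ^ m • x)‖ₑ)
  · have hq' : 0 < q.toReal := ENNReal.toReal_pos hq.ne' hqt
    simp_rw [h, ENNReal.mul_rpow_of_nonneg (2 ^ ((m : ℝ) * (n + s))) _ hq'.le]
    rw [ENNReal.tsum_mul_left, ENNReal.mul_rpow_of_nonneg _ _ (by positivity),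
      ← ENNReal.rpow_mul (2 ^ ((m : ℝ) * (n + s))), mul_one_div_cancel hq'.ne', ENNReal.rpow_one]
    congr 2
    exact (Equiv.subRight m).tsum_eq
      (fun l : ℤ => ((2 : ℝ≥0∞) ^ ((l : ℝ) * s) * ‖block ψ l u ((2 : ℝ) ^ m • x)‖ₑ) ^ q.toReal)

/-- The quasinorm of a dyadic dilate. -/
theorem tlNorm_fourierInv_dyadic (ψ : CutOff n) (s : ℝ) {p : ℝ} (hp : 0 < p) (q : ℝ≥0∞)
    (hq : 0 < q) (m : ℤ) (F : 𝓢(EuclideanSpace ℝ (Fin n), ℂ)) :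
    tlNorm ψ s p q ((𝓕⁻ (dyadic m F) : 𝓢(EuclideanSpace ℝ (Fin n), ℂ)) :
        𝓢'(EuclideanSpace ℝ (Fin n), ℂ)) =
      2 ^ ((m : ℝ) * (n + s - n / p)) * tlNorm ψ s p q
        ((𝓕⁻ F : 𝓢(EuclideanSpace ℝ (Fin n), ℂ)) : 𝓢'(EuclideanSpace ℝ (Fin n), ℂ)) := by
  set u : 𝓢'(EuclideanSpace ℝ (Fin n), ℂ) := ((𝓕⁻ F : 𝓢(EuclideanSpace ℝ (Fin n), ℂ)) :
        𝓢'(EuclideanSpace ℝ (Fin n), ℂ)) with hu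
  have h1 := lintegral_comp_two_zpow_smul (fun x => squareFun ψ s q u x ^ p) m
  rw [finrank_euclideanSpace_fin] at h1
  simp only [tlNorm, squareFun_fourierInv_dyadic ψ s q hq]
  rw [← h1]
  simp_rw [ENNReal.mul_rpow_of_nonneg (2 ^ ((m : ℝ) * (n + s))) _ hp.le]
  rw [lintegral_const_mul' _ _ (ENNReal.rpow_ne_top_of_nonneg hp.le (two_rpow_ne_top _)),
    ENNReal.mul_rpow_of_nonneg _ _ (by positivity), ENNReal.mul_rpow_of_nonneg _ _ (by positivity),
    ← ENNReal.rpow_mul, ← ENNReal.rpow_mul, ← ENNReal.rpow_mul, mul_one_div_cancel hp.ne', mul_one,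
    ← mul_assoc, ← two_rpow_add]
  congr 2
  field_simp
  ring

end BlockAlgebra

/-! ### Wave packets -/

section Packets

theorem CutOff.phi_eq_zero_of_lt (ψ : CutOff n) {ξ : EuclideanSpace ℝ (Fin n)}
    (h : ‖ξ‖ < 1 / 2) : ψ.phi ξ = 0 := by
  rw [CutOff.phi, ψ.eq_one _ (by linarith), ψ.eq_one, sub_self]
  rw [norm_smul, Real.norm_of_nonneg zero_le_two]
  linarith

/-- The support condition allows ψ ≠ 0 only in the closed ball of radius 2; that ψ also vanishes on
its boundary follows by continuity along the ray. -/
theorem CutOff.phi_eq_one (ψ : CutOff n) {ξ : EuclideanSpace ℝ (Fin n)} (h : ‖ξ‖ = 1) :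
    ψ.phi ξ = 1 := by
  have hc : Continuous fun t : ℝ => ψ.toFun (t • ξ) :=
    ψ.smooth.continuous.comp (continuous_id.smul continuous_const)
  have h0 : Set.EqOn (fun t : ℝ => ψ.toFun (t • ξ)) (fun _ => 0) (Set.Ioi 2) := fun t ht => by
    refine ψ.toFun_eq_zero ?_
    have ht' : (2 : ℝ) < t := ht
    rw [norm_smul, h, mul_one, Real.norm_of_nonneg (by linarith)]
    exact ht'
  have h1 := h0.closure hc continuous_const
  rw [closure_Ioi] at h1
  have h2 : ψ.toFun ((2 : ℝ) • ξ) = 0 := h1 (Set.mem_Ici.2 le_rfl)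
  rw [CutOff.phi, h2, ψ.eq_one _ h.le, sub_zero]

/-- A nonnegative bump on the frequency side, so concentrated that `φ ≥ 1/2` on all its
contractions moved to the unit vector `dir`. -/
structure Packet (ψ : CutOff n) where
  /-- A unit vector. -/
  dir : EuclideanSpace ℝ (Fin n)
  norm_dir : ‖dir‖ = 1
  /-- The bump as a real function. -/
  bump : EuclideanSpace ℝ (Fin n) → ℝ
  /-- The bump as a Schwartz function. -/
  schwartz : 𝓢(EuclideanSpace ℝ (Fin n), ℂ)
  schwartz_apply : ∀ η, schwartz η = (bump η : ℂ)
  nonneg : ∀ η, 0 ≤ bump η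
  norm_le : ∀ η, bump η ≠ 0 → ‖η‖ ≤ 1 / 8
  integrable : Integrable bump
  integral_pos : 0 < ∫ η, bump η
  phi_ge : ∀ η, bump η ≠ 0 → ∀ t : ℝ, 0 ≤ t → t ≤ 1 → 1 / 2 ≤ ψ.phi (dir + t • η)

/-- The dimension is positive, so there is a unit vector; φ = 1 there and φ is continuous, so a
small enough bump works. -/
theorem nonempty_packet (hn : 1 ≤ n) (ψ : CutOff n) : Nonempty (Packet ψ) := by
  let e : EuclideanSpace ℝ (Fin n) := EuclideanSpace.single ⟨0, hn⟩ 1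
  have he : ‖e‖ = 1 := by simp [e]
  have hphic : Continuous ψ.phi := by
    have := (ψ.contDiff_phiK 0).continuous
    have h0 : ψ.phiK 0 = ψ.phi := by
      ext ξ
      simp [CutOff.phiK]
    rwa [h0] at this
  have hev : ∀ᶠ ξ in nhds e, 1 / 2 < ψ.phi ξ :=
    hphic.continuousAt.eventually (lt_mem_nhds (by rw [ψ.phi_eq_one he]; norm_num))
  obtain ⟨ε, hε, hball⟩ := Metric.eventually_nhds_iff.1 hev
  have hδ : 0 < min ε (1 / 8) := lt_min hε (by norm_num)
  let f : ContDiffBump (0 : EuclideanSpace ℝ (Fin n)) :=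
    { rIn := min ε (1 / 8) / 2
      rOut := min ε (1 / 8)
      rIn_pos := by positivity
      rIn_lt_rOut := by linarith }
  have hsupp : ∀ η, f η ≠ 0 → ‖η‖ < min ε (1 / 8) := fun η hη => by
    have : η ∈ Function.support f := hη
    rw [f.support_eq] at this
    exact mem_ball_zero_iff.1 this
  exact ⟨{
    dir := e
    norm_dir := he
    bump := f
    schwartz := HasCompactSupport.toSchwartzMap (f := fun η => (f η : ℂ))
      (f.hasCompactSupport.comp_left (g := fun r : ℝ => (r : ℂ)) Complex.ofReal_zero)
      (Complex.ofRealCLM.contDiff.comp f.contDiff)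
    schwartz_apply := fun _ => rfl
    nonneg := fun _ => f.nonneg
    norm_le := fun η hη => ((hsupp η hη).trans_le (min_le_right _ _)).le
    integrable := f.integrable
    integral_pos := f.integral_pos
    phi_ge := fun η hη t ht0 ht1 => by
      refine (hball ?_).le
      rw [dist_eq_norm, add_sub_cancel_left, norm_smul, Real.norm_of_nonneg ht0]
      calc t * ‖η‖ ≤ 1 * ‖η‖ := by gcongr
        _ < ε := by rw [one_mul]; exact (hsupp η hη).trans_le (min_le_left _ _) }⟩

variable {ψ : CutOff n}

/-- The bump moved to the frequency `2ᵏ dir`. -/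
def Packet.freq (P : Packet ψ) (k : ℤ) : 𝓢(EuclideanSpace ℝ (Fin n), ℂ) :=
  SchwartzMap.compSubConstCLM ℂ ((2 : ℝ) ^ k • P.dir) P.schwartz

/-- The wave packet of frequency `2ᵏ dir`. -/
def Packet.wave (P : Packet ψ) (k : ℤ) : 𝓢(EuclideanSpace ℝ (Fin n), ℂ) := 𝓕⁻ (P.freq k)

theorem Packet.freq_apply (P : Packet ψ) (k : ℤ) (ξ : EuclideanSpace ℝ (Fin n)) :
    P.freq k ξ = (P.bump (ξ - (2 : ℝ) ^ k • P.dir) : ℂ) := by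
  rw [Packet.freq, SchwartzMap.compSubConstCLM_apply, P.schwartz_apply]

/-- For k ≥ 0 the packet has frequencies within 1/8 of a point of norm 2ᵏ, while φ_l lives on
2^{l-1} ≤ |ξ| ≤ 2^{l+1}; only l = k-1, k, k+1 can meet it. -/
theorem Packet.block_wave_eq_zero (P : Packet ψ) {k l : ℤ} (hk : 0 ≤ k)
    (hl : l < k - 1 ∨ k + 1 < l) (x : EuclideanSpace ℝ (Fin n)) :
    block ψ l (P.wave k : 𝓢'(EuclideanSpace ℝ (Fin n), ℂ)) x = 0 := by
  rw [Packet.wave, block_fourierInv, ← integral_zero (EuclideanSpace ℝ (Fin n)) ℂ]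
  refine integral_congr_ae (Filter.Eventually.of_forall fun v => ?_)
  simp only
  rw [P.freq_apply]
  by_cases hb : P.bump (v - (2 : ℝ) ^ k • P.dir) = 0
  · rw [hb, Complex.ofReal_zero, mul_zero, mul_zero]
  have h1 := P.norm_le _ hb
  have hk1 : (1 : ℝ) ≤ 2 ^ k := one_le_zpow₀ one_le_two hk
  have hdir : ‖(2 : ℝ) ^ k • P.dir‖ = 2 ^ k := by
    rw [norm_smul, P.norm_dir, mul_one, Real.norm_of_nonneg (by positivity)]
  have hlo : (2 : ℝ) ^ k - 1 / 8 ≤ ‖v‖ := by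
    have := norm_sub_norm_le ((2 : ℝ) ^ k • P.dir) v
    rw [norm_sub_rev, hdir] at this
    linarith
  have hhi : ‖v‖ ≤ (2 : ℝ) ^ k + 1 / 8 := by
    have := norm_sub_norm_le v ((2 : ℝ) ^ k • P.dir)
    rw [hdir] at this
    linarith
  have hphi : ψ.phiK l v = 0 := by
    rw [CutOff.phiK]
    have hnorm : ‖(2 : ℝ) ^ (-l) • v‖ = 2 ^ (-l) * ‖v‖ := by
      rw [norm_smul, Real.norm_of_nonneg (by positivity)]
    rcases hl with hl | hl
    · refine ψ.phi_eq_zero ?_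
      rw [hnorm]
      have h2 : (2 : ℝ) ^ (2 - k) ≤ 2 ^ (-l) := zpow_le_zpow_right₀ one_le_two (by omega)
      have h3 : (2 : ℝ) ^ (2 - k) * 2 ^ k = 4 := by
        rw [← zpow_add₀ two_ne_zero, sub_add_cancel]; norm_num
      have h4 : (2 : ℝ) ^ (2 - k) * (7 / 8 * 2 ^ k) ≤ 2 ^ (-l) * ‖v‖ := by
        gcongr
        linarith
      nlinarith
    · refine ψ.phi_eq_zero_of_lt ?_
      rw [hnorm]
      have h2 : (2 : ℝ) ^ (-l) ≤ 2 ^ (-2 - k) := zpow_le_zpow_right₀ one_le_two (by omega)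
      have h3 : (2 : ℝ) ^ (-2 - k) * 2 ^ k = 1 / 4 := by
        rw [← zpow_add₀ two_ne_zero, sub_add_cancel]; norm_num
      have h4 : 2 ^ (-l) * ‖v‖ ≤ (2 : ℝ) ^ (-2 - k) * (9 / 8 * 2 ^ k) := by
        gcongr
        linarith
      nlinarith
  rw [hphi, Complex.ofReal_zero, zero_mul, mul_zero]

/-- Translation in frequency is a modulation, so all packets have the same modulus. This is why
their bounds are uniform in k. -/
theorem Packet.norm_wave (P : Packet ψ) (k : ℤ) (y : EuclideanSpace ℝ (Fin n)) :
    ‖P.wave k y‖ = ‖(𝓕⁻ P.schwartz) y‖ := by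
  have h : P.wave k y = Complex.exp (↑(2 * Real.pi * inner ℝ ((2 : ℝ) ^ k • P.dir) y) * Complex.I) *
      (𝓕⁻ P.schwartz) y := by
    rw [Packet.wave, SchwartzMap.fourierInv_coe, SchwartzMap.fourierInv_coe, Real.fourierInv_eq',
      Real.fourierInv_eq', ← integral_const_mul,
      ← integral_add_right_eq_self _ ((2 : ℝ) ^ k • P.dir)]
    refine integral_congr_ae (Filter.Eventually.of_forall fun v => ?_)
    simp only [smul_eq_mul]
    rw [← mul_assoc, ← Complex.exp_add, Packet.freq, SchwartzMap.compSubConstCLM_apply,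
      inner_add_left, add_sub_cancel_right]
    congr 2
    push_cast
    ring
  rw [h, norm_mul, Complex.norm_exp_ofReal_mul_I, one_mul]

/-- For l ≥ 0 the kernel is an L¹-normalised contraction of the one for l = 0, and a contraction
only lowers the weighted integral. -/
theorem exists_lintegral_one_add_pow_fourier_dyadic_le {V : Type*} [NormedAddCommGroup V]
    [InnerProductSpace ℝ V] [FiniteDimensional ℝ V] [MeasurableSpace V] [BorelSpace V]
    (g : 𝓢(V, ℂ)) (M : ℕ) : ∃ C : ℝ≥0, ∀ l : ℤ, 0 ≤ l →
      ∫⁻ z, (1 + ‖z‖ₑ) ^ M * ‖𝓕 (dyadic l g) z‖ₑ ≤ C := by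
  have hfin : ∫⁻ z, (1 + ‖z‖ₑ) ^ M * ‖𝓕 g z‖ₑ ≠ ⊤ := by
    have h := (integrable_one_add_pow_mul (𝓕 g) M).2.ne
    refine ne_of_eq_of_ne (lintegral_congr fun z => ?_) h
    rw [enorm_mul, enorm_pow, enorm_norm, ← ofReal_norm (1 + ‖z‖), Real.norm_of_nonneg
      (by positivity), ENNReal.ofReal_add zero_le_one (norm_nonneg z), ENNReal.ofReal_one,
      ofReal_norm]
  refine ⟨(∫⁻ z, (1 + ‖z‖ₑ) ^ M * ‖𝓕 g z‖ₑ).toNNReal, fun l hl => ?_⟩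
  rw [ENNReal.coe_toNNReal hfin,
    ← lintegral_comp_two_zpow_smul (fun z => (1 + ‖z‖ₑ) ^ M * ‖𝓕 g z‖ₑ) l,
    ← lintegral_const_mul' _ _ (two_rpow_ne_top _)]
  refine lintegral_mono fun z => ?_
  rw [enorm_fourier_dyadic_apply, mul_left_comm]
  gcongr
  rw [← ofReal_norm, ← ofReal_norm]
  refine ENNReal.ofReal_le_ofReal ?_
  rw [norm_smul, Real.norm_of_nonneg (by positivity)]
  exact le_mul_of_one_le_left (norm_nonneg z) (one_le_zpow₀ one_le_two hl)

/-- The blocks of the wave packets decay uniformly. -/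
theorem Packet.exists_enorm_block_wave_le (P : Packet ψ) (M : ℕ) :
    ∃ C : ℝ≥0, ∀ k l : ℤ, 0 ≤ l → ∀ x,
      ‖block ψ l (P.wave k : 𝓢'(EuclideanSpace ℝ (Fin n), ℂ)) x‖ₑ * (1 + ‖x‖ₑ) ^ M ≤ C := by
  obtain ⟨C₁, hC₁⟩ := exists_lintegral_one_add_pow_fourier_dyadic_le ψ.phiSchwartz M
  obtain ⟨C₂, hC₂0, hC₂⟩ := exists_one_add_pow_mul_iteratedFDeriv_le (𝓕⁻ P.schwartz) M 0
  have hw : ∀ k y, (1 + ‖y‖ₑ) ^ M * ‖P.wave k y‖ₑ ≤ C₂.toNNReal := fun k y => by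
    rw [← ofReal_norm, ← ofReal_norm, ← ENNReal.ofReal_one,
      ← ENNReal.ofReal_add zero_le_one (norm_nonneg _), ← ENNReal.ofReal_pow (by positivity),
      ← ENNReal.ofReal_mul (by positivity), P.norm_wave]
    refine ENNReal.ofReal_le_ofReal ?_
    simpa using hC₂ y
  refine ⟨C₁ * C₂.toNNReal, fun k l hl x => ?_⟩
  rw [block_eq, SchwartzMap.coe_apply]
  calc _ ≤ (∫⁻ y, ‖𝓕 (dyadic l ψ.phiSchwartz) (y - x)‖ₑ * ‖P.wave k y‖ₑ) * (1 + ‖x‖ₑ) ^ M := by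
        gcongr
        refine (enorm_integral_le_lintegral_enorm _).trans_eq ?_
        simp_rw [smul_eq_mul, enorm_mul, SchwartzMap.compSubConstCLM_apply]
    _ = ∫⁻ y, ‖𝓕 (dyadic l ψ.phiSchwartz) (y - x)‖ₑ * ‖P.wave k y‖ₑ * (1 + ‖x‖ₑ) ^ M :=
        (lintegral_mul_const' _ _ (by simp)).symm
    _ ≤ ∫⁻ y, (1 + ‖y - x‖ₑ) ^ M * ‖𝓕 (dyadic l ψ.phiSchwartz) (y - x)‖ₑ * C₂.toNNReal := by
        refine lintegral_mono fun y => ?_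
        calc _ ≤ ‖𝓕 (dyadic l ψ.phiSchwartz) (y - x)‖ₑ * ‖P.wave k y‖ₑ *
              ((1 + ‖y‖ₑ) * (1 + ‖y - x‖ₑ)) ^ M := by
              gcongr
              have := one_add_enorm_le_mul y x
              rwa [← enorm_neg (x - y), neg_sub] at this
          _ = (1 + ‖y - x‖ₑ) ^ M * ‖𝓕 (dyadic l ψ.phiSchwartz) (y - x)‖ₑ *
              ((1 + ‖y‖ₑ) ^ M * ‖P.wave k y‖ₑ) := by rw [mul_pow]; ring
          _ ≤ _ := by gcongr; exact hw k y
    _ = (∫⁻ z, (1 + ‖z‖ₑ) ^ M * ‖𝓕 (dyadic l ψ.phiSchwartz) z‖ₑ) * C₂.toNNReal := by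
        rw [lintegral_mul_const' _ _ ENNReal.coe_ne_top]
        congr 1
        exact lintegral_sub_right_eq_self
          (fun z => (1 + ‖z‖ₑ) ^ M * ‖𝓕 (dyadic l ψ.phiSchwartz) z‖ₑ) x
    _ ≤ _ := by
        rw [ENNReal.coe_mul]
        gcongr
        exact hC₁ l hl

/-- The main block of a wave packet is bounded below on the unit ball. -/
theorem Packet.le_norm_block_wave (P : Packet ψ) {k : ℤ} (hk : 0 ≤ k)
    {x : EuclideanSpace ℝ (Fin n)} (hx : ‖x‖ ≤ 1) :
    (∫ η, P.bump η) / 4 ≤ ‖block ψ k (P.wave k : 𝓢'(EuclideanSpace ℝ (Fin n), ℂ)) x‖ := by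
  set a := (2 : ℝ) ^ k • P.dir with ha
  set H : EuclideanSpace ℝ (Fin n) → ℂ := fun η =>
    Complex.exp (↑(2 * Real.pi * inner ℝ η x) * Complex.I) *
      (ψ.phi (P.dir + (2 : ℝ) ^ (-k) • η) * P.bump η) with hH
  have h1 : block ψ k (P.wave k : 𝓢'(EuclideanSpace ℝ (Fin n), ℂ)) x =
      Complex.exp (↑(2 * Real.pi * inner ℝ a x) * Complex.I) * ∫ η, H η := by
    rw [Packet.wave, block_fourierInv, ← integral_const_mul, ← integral_add_right_eq_self _ a]
    refine integral_congr_ae (Filter.Eventually.of_forall fun v => ?_)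
    simp only [hH]
    have ha2 : (2 : ℝ) ^ (-k) • (v + a) = P.dir + (2 : ℝ) ^ (-k) • v := by
      rw [ha, smul_add, smul_smul, ← zpow_add₀ two_ne_zero, neg_add_cancel, zpow_zero, one_smul,
        add_comm]
    rw [← mul_assoc (Complex.exp _) (Complex.exp _), ← Complex.exp_add, P.freq_apply, CutOff.phiK,
      ha2, ← ha, add_sub_cancel_right, inner_add_left]
    congr 2
    push_cast
    ring
  have hHint : Integrable H := by
    have h2 := (P.schwartz.integrable (μ := volume)).bdd_mul
      (c := SchwartzMap.seminorm ℂ 0 0 ψ.phiSchwartz)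
      (f := fun η => Complex.exp (↑(2 * Real.pi * inner ℝ η x) * Complex.I) *
        ψ.phiSchwartz (P.dir + (2 : ℝ) ^ (-k) • η))
      (Continuous.aestronglyMeasurable (by fun_prop))
      (Filter.Eventually.of_forall fun η => by
        rw [norm_mul, Complex.norm_exp_ofReal_mul_I, one_mul]
        exact ψ.phiSchwartz.norm_le_seminorm ℂ _)
    refine h2.congr (Filter.Eventually.of_forall fun η => ?_)
    simp only [hH]
    rw [ψ.phiSchwartz_apply, P.schwartz_apply, mul_assoc]
  rw [h1, norm_mul, Complex.norm_exp_ofReal_mul_I, one_mul]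
  -- With the phase removed, the real part of the integrand is cos · φ · bump. Here φ ≥ 1/2 by
  -- choice of the packet and cos ≥ 1/2 because |2π⟨η, x⟩| ≤ 2π/8 < 1, whence the 1/4.
  refine le_trans ?_ (Complex.re_le_norm _)
  have h2 : (∫ η, H η).re = ∫ η, (H η).re := (integral_re hHint).symm
  rw [h2, ← integral_div]
  refine integral_mono (P.integrable.div_const 4) hHint.re fun η => ?_
  have h3 : (H η).re = Real.cos (2 * Real.pi * inner ℝ η x) *
      (ψ.phi (P.dir + (2 : ℝ) ^ (-k) • η) * P.bump η) := by
    simp only [hH]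
    rw [← Complex.ofReal_mul, Complex.re_mul_ofReal, Complex.exp_ofReal_mul_I_re]
  change P.bump η / 4 ≤ (H η).re
  rw [h3]
  by_cases hb : P.bump η = 0
  · simp [hb]
  have hphi := P.phi_ge η hb (2 ^ (-k)) (by positivity)
    (zpow_le_one_of_nonpos₀ one_le_two (by omega))
  have hinner : |inner ℝ η x| ≤ 1 / 8 := by
    refine (abs_real_inner_le_norm η x).trans ?_
    calc ‖η‖ * ‖x‖ ≤ 1 / 8 * 1 := by gcongr; exact P.norm_le η hb
      _ = 1 / 8 := mul_one _
  have harg : |2 * Real.pi * inner ℝ η x| ≤ 1 := by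
    rw [abs_mul, abs_of_pos (by positivity : (0 : ℝ) < 2 * Real.pi)]
    nlinarith [Real.pi_lt_four, Real.pi_pos, abs_nonneg (inner ℝ η x)]
  have hcos : 1 / 2 ≤ Real.cos (2 * Real.pi * inner ℝ η x) := by
    have h4 := Real.one_sub_sq_div_two_le_cos (x := 2 * Real.pi * inner ℝ η x)
    have h5 : (2 * Real.pi * inner ℝ η x) ^ 2 ≤ 1 := (sq_le_one_iff_abs_le_one _).2 harg
    linarith
  have hb0 := P.nonneg η
  calc P.bump η / 4 = 1 / 2 * (1 / 2 * P.bump η) := by ring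
    _ ≤ _ := by gcongr

end Packets

/-! ### Norms of sums of separated packets -/

section Combinations

variable {ψ : CutOff n}

/-- A linear combination of the wave packets of frequencies `2⁴, 2⁸, 2¹², …`, which do not
interact. -/
def Packet.comb (P : Packet ψ) (A : Finset ℕ) (c : ℕ → ℂ) :
    𝓢'(EuclideanSpace ℝ (Fin n), ℂ) :=
  ∑ j ∈ A, c j • (P.wave (4 * ((j : ℤ) + 1)) : 𝓢'(EuclideanSpace ℝ (Fin n), ℂ))

/-- The spacing 4 makes the windows of radius 1 around the packet indices disjoint, so each block
sees at most one packet. -/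
theorem Packet.block_comb_eq_of_near (P : Packet ψ) {A : Finset ℕ} (c : ℕ → ℂ) {j : ℕ}
    (hj : j ∈ A) {l : ℤ} (h1 : 4 * ((j : ℤ) + 1) - 1 ≤ l) (h2 : l ≤ 4 * ((j : ℤ) + 1) + 1)
    (x : EuclideanSpace ℝ (Fin n)) :
    block ψ l (P.comb A c) x =
      c j * block ψ l (P.wave (4 * ((j : ℤ) + 1)) : 𝓢'(EuclideanSpace ℝ (Fin n), ℂ)) x := by
  rw [Packet.comb, block_sum, Finset.sum_eq_single j, block_smul]
  · intro i _ hij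
    rw [block_smul, P.block_wave_eq_zero (by positivity) (by omega), mul_zero]
  · exact fun h => (h hj).elim

theorem Packet.block_comb_eq_zero (P : Packet ψ) {A : Finset ℕ} (c : ℕ → ℂ) {l : ℤ}
    (h : ∀ j ∈ A, l < 4 * ((j : ℤ) + 1) - 1 ∨ 4 * ((j : ℤ) + 1) + 1 < l)
    (x : EuclideanSpace ℝ (Fin n)) : block ψ l (P.comb A c) x = 0 := by
  rw [Packet.comb, block_sum]
  refine Finset.sum_eq_zero fun j hj => ?_
  rw [block_smul, P.block_wave_eq_zero (by positivity) (h j hj), mul_zero]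

/-- Each l meets at most one packet, so the supremum over l sees only the largest coefficient and
the number of packets does not enter. The factor 2^{|t|} pays for l being off by one. -/
theorem Packet.exists_squareFun_comb_mul_le (P : Packet ψ) (t : ℝ) (M : ℕ) :
    ∃ K : ℝ≥0, ∀ (A : Finset ℕ) (c : ℕ → ℂ) (H : ℝ≥0∞),
      (∀ j ∈ A, (2 : ℝ≥0∞) ^ ((4 * ((j : ℝ) + 1)) * t) * ‖c j‖ₑ ≤ H) → ∀ x,
        squareFun ψ t ⊤ (P.comb A c) x * (1 + ‖x‖ₑ) ^ M ≤ H * K := by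
  obtain ⟨C, hC⟩ := P.exists_enorm_block_wave_le M
  refine ⟨((2 : ℝ≥0∞) ^ |t|).toNNReal * C, fun A c H hH x => ?_⟩
  rw [ENNReal.coe_mul, ENNReal.coe_toNNReal (two_rpow_ne_top _), squareFun_top, ENNReal.iSup_mul]
  refine iSup_le fun l => ?_
  by_cases h : ∃ j ∈ A, 4 * ((j : ℤ) + 1) - 1 ≤ l ∧ l ≤ 4 * ((j : ℤ) + 1) + 1
  · obtain ⟨j, hj, h1, h2⟩ := h
    rw [P.block_comb_eq_of_near c hj h1 h2, enorm_mul]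
    have hlt : (l : ℝ) * t ≤ |t| + 4 * ((j : ℝ) + 1) * t := by
      have h1' : 4 * ((j : ℝ) + 1) - 1 ≤ l := by exact_mod_cast h1
      have h2' : (l : ℝ) ≤ 4 * ((j : ℝ) + 1) + 1 := by exact_mod_cast h2
      have h3 : |(l - 4 * ((j : ℝ) + 1)) * t| ≤ 1 * |t| := by
        rw [abs_mul]
        gcongr
        exact abs_le.2 ⟨by linarith, by linarith⟩
      linarith [le_abs_self ((l - 4 * ((j : ℝ) + 1)) * t)]
    calc _ ≤ (2 : ℝ≥0∞) ^ (|t| + 4 * ((j : ℝ) + 1) * t) * (‖c j‖ₑ *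
          ‖block ψ l (P.wave (4 * ((j : ℤ) + 1)) : 𝓢'(EuclideanSpace ℝ (Fin n), ℂ)) x‖ₑ) *
            (1 + ‖x‖ₑ) ^ M := by
          gcongr
          norm_num
      _ = (2 ^ (4 * ((j : ℝ) + 1) * t) * ‖c j‖ₑ) * (2 ^ |t| *
          (‖block ψ l (P.wave (4 * ((j : ℤ) + 1)) : 𝓢'(EuclideanSpace ℝ (Fin n), ℂ)) x‖ₑ *
            (1 + ‖x‖ₑ) ^ M)) := by rw [two_rpow_add]; ring
      _ ≤ _ := by
          gcongr
          · exact hH j hj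
          · exact hC _ _ (by omega) _
  · push Not at h
    rw [P.block_comb_eq_zero c fun j hj => ?_]
    · simp
    · rcases lt_or_ge l (4 * ((j : ℤ) + 1) - 1) with h' | h'
      · exact Or.inl h'
      · exact Or.inr (h j hj h')

theorem lintegral_one_add_enorm_pow_inv_rpow_ne_top {M : ℕ} {r : ℝ} (hM : (n : ℝ) < M * r) :
    ∫⁻ x : EuclideanSpace ℝ (Fin n), (((1 + ‖x‖ₑ) ^ M)⁻¹) ^ r ≠ ⊤ := by
  have h := (finite_integral_one_add_norm (E := EuclideanSpace ℝ (Fin n)) (μ := volume)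
    (r := M * r) (by rwa [finrank_euclideanSpace_fin])).ne
  refine ne_of_eq_of_ne (lintegral_congr fun x => ?_) h
  rw [← ENNReal.ofReal_rpow_of_pos (by positivity), ENNReal.ofReal_add zero_le_one
    (norm_nonneg x), ENNReal.ofReal_one, ofReal_norm, ← ENNReal.rpow_natCast, ← ENNReal.rpow_neg,
    ← ENNReal.rpow_mul, neg_mul]

/-- Upper bound for the quasinorms with `q = ∞` of combinations of wave packets. -/
theorem Packet.exists_tlNorm_comb_le (P : Packet ψ) (t : ℝ) {r : ℝ} (hr : 0 < r) :
    ∃ K : ℝ≥0, ∀ (A : Finset ℕ) (c : ℕ → ℂ) (H : ℝ≥0∞),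
      (∀ j ∈ A, (2 : ℝ≥0∞) ^ ((4 * ((j : ℝ) + 1)) * t) * ‖c j‖ₑ ≤ H) →
        tlNorm ψ t r ⊤ (P.comb A c) ≤ H * K := by
  -- M r > n makes (1 + ‖x‖)^{-M} an L^r function.
  obtain ⟨M, hM⟩ := exists_nat_gt ((n : ℝ) / r)
  rw [div_lt_iff₀ hr] at hM
  have hJ := lintegral_one_add_enorm_pow_inv_rpow_ne_top hM
  set J := ∫⁻ x : EuclideanSpace ℝ (Fin n), (((1 + ‖x‖ₑ) ^ M)⁻¹) ^ r with hJdef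
  have hJr : J ^ (1 / r) ≠ ⊤ := ENNReal.rpow_ne_top_of_nonneg (by positivity) hJ
  obtain ⟨K, hK⟩ := P.exists_squareFun_comb_mul_le t M
  refine ⟨K * (J ^ (1 / r)).toNNReal, fun A c H hH => ?_⟩
  rw [ENNReal.coe_mul, ENNReal.coe_toNNReal hJr]
  calc tlNorm ψ t r ⊤ (P.comb A c)
      ≤ (∫⁻ x, (H * K) ^ r * (((1 + ‖x‖ₑ) ^ M)⁻¹) ^ r) ^ (1 / r) := by
        refine ENNReal.rpow_le_rpow (lintegral_mono fun x => ?_) (by positivity)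
        simp only
        rw [← ENNReal.mul_rpow_of_nonneg _ _ hr.le]
        gcongr
        rw [← div_eq_mul_inv, ENNReal.le_div_iff_mul_le (Or.inl (by simp)) (Or.inl (by simp))]
        exact hK A c H hH x
    _ = H * K * J ^ (1 / r) := by
        rw [lintegral_const_mul _ (by fun_prop), ENNReal.mul_rpow_of_nonneg _ _ (by positivity),
          ← ENNReal.rpow_mul, mul_one_div_cancel hr.ne', ENNReal.rpow_one]
    _ = _ := mul_assoc _ _ _

/-- Lower bound for the quasinorms with `q < ∞` of combinations of wave packets. -/
theorem Packet.exists_le_tlNorm_comb (P : Packet ψ) (s : ℝ) {p q : ℝ} (hp : 0 < p)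
    (hq : 0 < q) : ∃ a : ℝ≥0∞, a ≠ 0 ∧ ∀ (A : Finset ℕ) (c : ℕ → ℂ) (h : ℝ≥0∞),
      (∀ j ∈ A, h ≤ (2 : ℝ≥0∞) ^ ((4 * ((j : ℝ) + 1)) * s) * ‖c j‖ₑ) →
        a * h * (A.card : ℝ≥0∞) ^ (1 / q) ≤ tlNorm ψ s p (ENNReal.ofReal q) (P.comb A c) := by
  set b := ENNReal.ofReal ((∫ η, P.bump η) / 4) with hb
  have hb0 : b ≠ 0 := by
    have := P.integral_pos
    rw [hb, Ne, ENNReal.ofReal_eq_zero, not_le]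
    positivity
  set B := Metric.closedBall (0 : EuclideanSpace ℝ (Fin n)) 1 with hB
  have hBvol : volume B ≠ 0 := (Metric.measure_closedBall_pos volume _ one_pos).ne'
  refine ⟨b * volume B ^ (1 / p), mul_ne_zero hb0 ?_, fun A c h hh => ?_⟩
  · simp [ENNReal.rpow_eq_zero_iff, hBvol, hp.le]
  have hpt : ∀ x ∈ B, b * h * (A.card : ℝ≥0∞) ^ (1 / q) ≤
      squareFun ψ s (ENNReal.ofReal q) (P.comb A c) x := fun x hx => by
    have hx1 : ‖x‖ ≤ 1 := by simpa [hB] using hx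
    rw [squareFun_ofReal ψ s hq]
    set F : ℤ → ℝ≥0∞ := fun k => ((2 : ℝ≥0∞) ^ ((k : ℝ) * s) * ‖block ψ k (P.comb A c) x‖ₑ) ^ q
    have hF : ∀ j ∈ A, (b * h) ^ q ≤ F (4 * ((j : ℤ) + 1)) := fun j hj => by
      refine ENNReal.rpow_le_rpow ?_ hq.le
      rw [P.block_comb_eq_of_near c hj (by omega) (by omega), enorm_mul, ← mul_assoc, mul_comm b h]
      gcongr
      · refine (hh j hj).trans_eq ?_
        push_cast
        rfl
      · rw [hb, ← ofReal_norm]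
        exact ENNReal.ofReal_le_ofReal (P.le_norm_block_wave (by positivity) hx1)
    have hinj : Function.Injective fun j : ℕ => 4 * ((j : ℤ) + 1) := fun i j hij => by
      simp only at hij
      omega
    -- Each packet contributes its own index to the ℓ^q sum; this is where q < ∞ counts the packets.
    have hsum : (A.card : ℝ≥0∞) * (b * h) ^ q ≤ ∑' k, F k := by
      calc (A.card : ℝ≥0∞) * (b * h) ^ q = ∑ _j ∈ A, (b * h) ^ q := by
            rw [Finset.sum_const, nsmul_eq_mul]
        _ ≤ ∑ j ∈ A, F (4 * ((j : ℤ) + 1)) := Finset.sum_le_sum hF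
        _ ≤ ∑' j : ℕ, F (4 * ((j : ℤ) + 1)) := ENNReal.sum_le_tsum A
        _ ≤ ∑' k, F k := ENNReal.tsum_comp_le_tsum_of_injective hinj F
    calc b * h * (A.card : ℝ≥0∞) ^ (1 / q) = ((A.card : ℝ≥0∞) * (b * h) ^ q) ^ (1 / q) := by
          rw [ENNReal.mul_rpow_of_nonneg _ _ (by positivity), ← ENNReal.rpow_mul,
            mul_one_div_cancel hq.ne', ENNReal.rpow_one, mul_comm]
      _ ≤ _ := by gcongr
  set m := b * h * (A.card : ℝ≥0∞) ^ (1 / q) with hm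
  calc b * volume B ^ (1 / p) * h * (A.card : ℝ≥0∞) ^ (1 / q) = m * volume B ^ (1 / p) := by
        rw [hm]; ring
    _ = (m ^ p * volume B) ^ (1 / p) := by
        rw [ENNReal.mul_rpow_of_nonneg _ _ (by positivity), ← ENNReal.rpow_mul,
          mul_one_div_cancel hp.ne', ENNReal.rpow_one]
    _ = (∫⁻ x, B.indicator (fun _ => m ^ p) x) ^ (1 / p) := by
        rw [lintegral_indicator_const measurableSet_closedBall]
    _ ≤ _ := by
        refine ENNReal.rpow_le_rpow (lintegral_mono fun x => ?_) (by positivity)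
        by_cases hx : x ∈ B
        · rw [Set.indicator_of_mem hx]
          exact ENNReal.rpow_le_rpow (hpt x hx) hp.le
        · rw [Set.indicator_of_notMem hx]
          exact zero_le

end Combinations

/-! ### Testing the inequality -/

section Necessity

theorem nonpos_of_forall_mul_two_rpow_le {κ : ℝ} {a D : ℝ≥0∞} (ha : a ≠ 0) (hD : D ≠ ⊤)
    (h : ∀ j : ℕ, a * (2 : ℝ≥0∞) ^ ((j : ℝ) * κ) ≤ D) : κ ≤ 0 := by
  by_contra! hκ
  have hDa : D / a ≠ ⊤ := ENNReal.div_ne_top hD ha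
  obtain ⟨j, hj⟩ := pow_unbounded_of_one_lt (D / a).toReal (Real.one_lt_rpow one_lt_two hκ)
  have h1 : (2 : ℝ≥0∞) ^ ((j : ℝ) * κ) ≤ D / a := by
    rw [ENNReal.le_div_iff_mul_le (Or.inl ha) (Or.inr hD), mul_comm]
    exact h j
  have h2 := ENNReal.toReal_mono hDa h1
  rw [← ENNReal.toReal_rpow, ENNReal.toReal_ofNat, mul_comm, Real.rpow_mul zero_le_two,
    Real.rpow_natCast] at h2
  linarith

/-- The three conditions are necessary for the Gagliardo–Nirenberg inequality. -/
theorem conditions_of_tlNorm_le (hn : 1 ≤ n) (ψ : CutOff n)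
    {p p₀ p₁ q s s₀ s₁ θ : ℝ} (hp : 0 < p) (hp₀ : 0 < p₀) (hp₁ : 0 < p₁) (hq : 0 < q)
    (hθ₀ : 0 < θ) (hθ₁ : θ < 1) {C : ℝ≥0}
    (hC : ∀ u ∈ tlSpace ψ s₀ p₀ ⊤ ∩ tlSpace ψ s₁ p₁ ⊤,
      tlNorm ψ s p (ENNReal.ofReal q) u ≤
        C * tlNorm ψ s₀ p₀ ⊤ u ^ (1 - θ) * tlNorm ψ s₁ p₁ ⊤ u ^ θ) :
    (n : ℝ) / p - s = (1 - θ) * ((n : ℝ) / p₀ - s₀) + θ * ((n : ℝ) / p₁ - s₁) ∧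
      s ≤ (1 - θ) * s₀ + θ * s₁ ∧ (s = (1 - θ) * s₀ + θ * s₁ → s₀ ≠ s₁) := by
  have hθ' : 0 < 1 - θ := by linarith
  obtain ⟨P⟩ := nonempty_packet hn ψ
  obtain ⟨K₀, hK₀⟩ := P.exists_tlNorm_comb_le s₀ hp₀
  obtain ⟨K₁, hK₁⟩ := P.exists_tlNorm_comb_le s₁ hp₁
  obtain ⟨a, ha, hlow⟩ := P.exists_le_tlNorm_comb s hp hq
  have hfin : ∀ X Y : ℝ≥0∞, X ≠ ⊤ → Y ≠ ⊤ → (C : ℝ≥0∞) * X ^ (1 - θ) * Y ^ θ ≠ ⊤ :=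
    fun X Y hX hY => ENNReal.mul_ne_top (ENNReal.mul_ne_top ENNReal.coe_ne_top
      (ENNReal.rpow_ne_top_of_nonneg hθ'.le hX)) (ENNReal.rpow_ne_top_of_nonneg hθ₀.le hY)
  -- The assumed inequality between the lower and upper bounds for a combination of packets, with
  -- constants independent of A and c.
  have hcomb : ∀ (A : Finset ℕ) (c : ℕ → ℂ) (h H₀ H₁ : ℝ≥0∞), H₀ ≠ ⊤ → H₁ ≠ ⊤ →
      (∀ j ∈ A, h ≤ (2 : ℝ≥0∞) ^ ((4 * ((j : ℝ) + 1)) * s) * ‖c j‖ₑ) →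
      (∀ j ∈ A, (2 : ℝ≥0∞) ^ ((4 * ((j : ℝ) + 1)) * s₀) * ‖c j‖ₑ ≤ H₀) →
      (∀ j ∈ A, (2 : ℝ≥0∞) ^ ((4 * ((j : ℝ) + 1)) * s₁) * ‖c j‖ₑ ≤ H₁) →
      a * h * (A.card : ℝ≥0∞) ^ (1 / q) ≤ C * (H₀ * K₀) ^ (1 - θ) * (H₁ * K₁) ^ θ := by
    intro A c h H₀ H₁ hH₀ hH₁ hh h₀ h₁
    have e₀ := hK₀ A c H₀ h₀
    have e₁ := hK₁ A c H₁ h₁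
    refine (hlow A c h hh).trans ((hC _ ⟨?_, ?_⟩).trans ?_)
    · exact e₀.trans_lt (ENNReal.mul_lt_top hH₀.lt_top ENNReal.coe_lt_top)
    · exact e₁.trans_lt (ENNReal.mul_lt_top hH₁.lt_top ENNReal.coe_lt_top)
    · gcongr
  have hD := hfin K₀ K₁ ENNReal.coe_ne_top ENNReal.coe_ne_top
  refine ⟨?_, ?_, ?_⟩
  -- Condition 1: both sides for a fixed packet (j = 0, frequency 2⁴) scale exactly under dilation
  -- by 2ᵐ, and κ is the difference of the two scaling exponents. Positive and negative m give κ ≤ 0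
  -- and -κ ≤ 0.
  · set F := P.freq 4 with hF
    set u : 𝓢'(EuclideanSpace ℝ (Fin n), ℂ) :=
      ((𝓕⁻ F : 𝓢(EuclideanSpace ℝ (Fin n), ℂ)) : 𝓢'(EuclideanSpace ℝ (Fin n), ℂ)) with hu
    have hu' : P.comb {0} (fun _ => 1) = u := by
      simp [Packet.comb, hu, hF, Packet.wave]
    have hN₀ : tlNorm ψ s₀ p₀ ⊤ u ≠ ⊤ := by
      have := hK₀ {0} (fun _ => 1) (2 ^ (4 * s₀)) (by simp)
      rw [hu'] at this
      exact ne_top_of_le_ne_top (ENNReal.mul_ne_top (two_rpow_ne_top _) ENNReal.coe_ne_top) this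
    have hN₁ : tlNorm ψ s₁ p₁ ⊤ u ≠ ⊤ := by
      have := hK₁ {0} (fun _ => 1) (2 ^ (4 * s₁)) (by simp)
      rw [hu'] at this
      exact ne_top_of_le_ne_top (ENNReal.mul_ne_top (two_rpow_ne_top _) ENNReal.coe_ne_top) this
    have hN : tlNorm ψ s p (ENNReal.ofReal q) u ≠ 0 := by
      have := hlow {0} (fun _ => 1) (2 ^ (4 * s)) (by simp)
      rw [hu'] at this
      intro h0
      rw [h0] at this
      simp [ha] at this
    set κ := ((n : ℝ) + s - n / p) - ((1 - θ) * (n + s₀ - n / p₀) + θ * (n + s₁ - n / p₁)) with hκ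
    have hm : ∀ m : ℤ, tlNorm ψ s p (ENNReal.ofReal q) u * (2 : ℝ≥0∞) ^ ((m : ℝ) * κ) ≤
        C * tlNorm ψ s₀ p₀ ⊤ u ^ (1 - θ) * tlNorm ψ s₁ p₁ ⊤ u ^ θ := fun m => by
      have h := hC ((𝓕⁻ (dyadic m F) : 𝓢(EuclideanSpace ℝ (Fin n), ℂ)) :
        𝓢'(EuclideanSpace ℝ (Fin n), ℂ)) (by
          constructor
          · change tlNorm _ _ _ _ _ < ⊤
            rw [tlNorm_fourierInv_dyadic ψ _ hp₀ _ ENNReal.zero_lt_top]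
            exact ENNReal.mul_lt_top (two_rpow_ne_top _).lt_top hN₀.lt_top
          · change tlNorm _ _ _ _ _ < ⊤
            rw [tlNorm_fourierInv_dyadic ψ _ hp₁ _ ENNReal.zero_lt_top]
            exact ENNReal.mul_lt_top (two_rpow_ne_top _).lt_top hN₁.lt_top)
      rw [tlNorm_fourierInv_dyadic ψ _ hp₀ _ ENNReal.zero_lt_top,
        tlNorm_fourierInv_dyadic ψ _ hp₁ _ ENNReal.zero_lt_top,
        tlNorm_fourierInv_dyadic ψ _ hp _ (ENNReal.ofReal_pos.2 hq), ← hu,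
        ENNReal.mul_rpow_of_nonneg _ _ hθ'.le, ENNReal.mul_rpow_of_nonneg _ _ hθ₀.le,
        ← ENNReal.rpow_mul, ← ENNReal.rpow_mul] at h
      set e := (m : ℝ) * (n + s₀ - n / p₀) * (1 - θ) + m * (n + s₁ - n / p₁) * θ with he
      have hexp : (m : ℝ) * (n + s - n / p) = m * κ + e := by rw [hκ, he]; ring
      rw [hexp, two_rpow_add] at h
      rw [← ENNReal.mul_le_mul_iff_left (two_rpow_ne_zero e) (two_rpow_ne_top e)]
      refine (le_of_eq ?_).trans (h.trans_eq ?_)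
      · ring
      · rw [he, two_rpow_add]; ring
    have h1 := nonpos_of_forall_mul_two_rpow_le hN (hfin _ _ hN₀ hN₁) (fun j => by
      simpa using hm j)
    have h2 := nonpos_of_forall_mul_two_rpow_le (κ := -κ) hN (hfin _ _ hN₀ hN₁) (fun j => by
      simpa using hm (-j))
    have h3 : κ = 0 := le_antisymm h1 (by linarith)
    rw [hκ] at h3
    linarith
  -- Condition 2: one packet with coefficient 1 and frequency 2^{4(j+1)}, j → ∞. The shift j + 1
  -- puts an extra power of 2 into the constant.
  · have h := nonpos_of_forall_mul_two_rpow_le (κ := 4 * (s - ((1 - θ) * s₀ + θ * s₁)))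
      (a := a * 2 ^ (4 * (s - ((1 - θ) * s₀ + θ * s₁)))) (mul_ne_zero ha (two_rpow_ne_zero _)) hD
      (fun j => by
        have h := hcomb {j} (fun _ => 1) (2 ^ (4 * ((j : ℝ) + 1) * s))
          (2 ^ (4 * ((j : ℝ) + 1) * s₀)) (2 ^ (4 * ((j : ℝ) + 1) * s₁)) (two_rpow_ne_top _)
          (two_rpow_ne_top _) (by simp) (by simp) (by simp)
        rw [Finset.card_singleton, Nat.cast_one, ENNReal.one_rpow, mul_one,
          ENNReal.mul_rpow_of_nonneg _ _ hθ'.le, ENNReal.mul_rpow_of_nonneg _ _ hθ₀.le,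
          ← ENNReal.rpow_mul, ← ENNReal.rpow_mul] at h
        set e := 4 * ((j : ℝ) + 1) * s₀ * (1 - θ) + 4 * ((j : ℝ) + 1) * s₁ * θ with he
        have hexp : 4 * ((j : ℝ) + 1) * s = 4 * (s - ((1 - θ) * s₀ + θ * s₁)) +
            j * (4 * (s - ((1 - θ) * s₀ + θ * s₁))) + e := by rw [he]; ring
        rw [hexp, two_rpow_add, two_rpow_add] at h
        rw [← ENNReal.mul_le_mul_iff_left (two_rpow_ne_zero e) (two_rpow_ne_top e)]
        refine (le_of_eq ?_).trans (h.trans_eq ?_)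
        · ring
        · rw [he, two_rpow_add]; ring)
    linarith
  -- Condition 3: now s = s₀ = s₁. Sum 2ʲ packets with coefficients making every weighted term 1;
  -- the left side grows like 2^{j/q} while the right side stays bounded, contradicting q < ∞.
  · rintro hs rfl
    have hs' : s = s₀ := by rw [hs]; ring
    have hone : ∀ i : ℕ, (2 : ℝ≥0∞) ^ ((4 * ((i : ℝ) + 1)) * s₀) *
        ‖(((2 : ℝ) ^ (-((4 * ((i : ℝ) + 1)) * s₀)) : ℝ) : ℂ)‖ₑ = 1 := fun i => by
      rw [← ofReal_norm, Complex.norm_real, Real.norm_of_nonneg (by positivity),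
        ← ENNReal.ofReal_rpow_of_pos two_pos, ENNReal.ofReal_ofNat, ← two_rpow_add,
        add_neg_cancel, ENNReal.rpow_zero]
    have h := nonpos_of_forall_mul_two_rpow_le (κ := 1 / q) ha hD (fun j => by
      have h := hcomb (Finset.range (2 ^ j))
        (fun i => (((2 : ℝ) ^ (-((4 * ((i : ℝ) + 1)) * s₀)) : ℝ) : ℂ)) 1 1 1
        ENNReal.one_ne_top ENNReal.one_ne_top (fun i _ => by rw [hs', hone])
        (fun i _ => by rw [hone]) (fun i _ => by rw [hone])
      rw [Finset.card_range, mul_one, one_mul, one_mul] at h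
      rwa [ENNReal.rpow_mul, ENNReal.rpow_natCast, ← Nat.cast_ofNat, ← Nat.cast_pow])
    have : 0 < 1 / q := by positivity
    linarith

end Necessity

end TriebelLizorkin

end

theorem theorem1p4 {n : ℕ} (hn : 1 ≤ n) (ψ : TriebelLizorkin.CutOff n)
    (p p₀ p₁ q s s₀ s₁ θ : ℝ) (hp : 0 < p) (hp₀ : 0 < p₀) (hp₁ : 0 < p₁) (hq : 0 < q)
    (hθ₀ : 0 < θ) (hθ₁ : θ < 1) :
    (∃ C : ℝ≥0, ∀ u ∈ TriebelLizorkin.tlSpace ψ s₀ p₀ ⊤ ∩ TriebelLizorkin.tlSpace ψ s₁ p₁ ⊤,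
        TriebelLizorkin.tlNorm ψ s p (ENNReal.ofReal q) u ≤
          C * TriebelLizorkin.tlNorm ψ s₀ p₀ ⊤ u ^ (1 - θ) *
            TriebelLizorkin.tlNorm ψ s₁ p₁ ⊤ u ^ θ) ↔
      ((n : ℝ) / p - s = (1 - θ) * ((n : ℝ) / p₀ - s₀) + θ * ((n : ℝ) / p₁ - s₁) ∧
        s ≤ (1 - θ) * s₀ + θ * s₁ ∧
        (s = (1 - θ) * s₀ + θ * s₁ → s₀ ≠ s₁)) :=
  ⟨fun ⟨_, hC⟩ =>
    TriebelLizorkin.conditions_of_tlNorm_le hn ψ hp hp₀ hp₁ hq hθ₀ hθ₁ hC,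
  fun ⟨hdim, hle, hne⟩ =>
    TriebelLizorkin.exists_tlNorm_le_of_conditions hn ψ hp hp₀ hp₁ hq hθ₀ hθ₁ hdim hle hne⟩
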